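/- Let $g\ge 0$ and $-1<\alpha_1<\beta_1<\alpha_2<\beta_2<\dots<\alpha_g<\beta_g<1$. Put $E=[-1,\alpha_1]\cup[\beta_1,\alpha_2]\cup\dots\cup[\beta_g,1]$ (for $g=0$, $E=[-1,1]$) and $$w(x)=\frac1\pi\sqrt{\frac{\prod_{j=1}^g(x-\alpha_j)}{(1-x^2)\prod_{j=1}^g(x-\beta_j)}},\qquad x\in E.$$ Let $P_n$, $n\ge 0$, be the monic polynomials of degree $n$ that are orthogonal on $E$ with respect to $w$, let $h_n=\int_E P_n^2\,w\,dx$, and let $$Q_n(x)=\int_E\frac{P_n(x)-P_n(t)}{x-t}\,w(t)\,dt$$ be the polynomials of the second kind. Let $a_n,b_n$ $(n\ge 1)$ be the coefficients of the recurrence $xP_n=P_{n+1}+b_{n+1}P_n+a_nP_{n-1}$. Let $\psi(z)=\int_E\frac{w(t)\,dt}{z-t}$ for $z\in\mathbb C\setminus E$ and $\psi(x)=\frac{\pi}{i}w(x)$ for $x\in E$; at the points $\pm1,\beta_1,\dots,\beta_g$, where $\psi$ is infinite, $1/\psi^2$ is read as $0$. Let $\mathfrak K\ge 1$ be a period of the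 recurrence coefficients: $a_{n+\mathfrak K}=a_n$ for $n\ge 2$ and $b_{n+\mathfrak K}=b_n$ for $n\ge 1$. Then the following identities hold for all integers $m,n\ge 1$ and all complex $x$. 1. $$P_n(x)P_{m\mathfrak K}(x)=\begin{cases}P_{n+m\mathfrak K}(x)+\dfrac{h_{m\mathfrak K}}2\,P_{n-m\mathfrak K}(x), & n>m\mathfrak K,\\[2mm] P_{n+m\mathfrak K}(x)+\dfrac{h_n}2\,P_{m\mathfrak K-n}(x), & n<m\mathfrak K,\\[2mm] P_{2m\mathfrak K}(x)+h_{m\mathfrak K}, & n=m\mathfrak K.\end{cases}$$ 2. $$Q_n(x)P_{m\mathfrak K}(x)=\begin{cases}Q_{n+m\mathfrak K}(x)+\dfrac{h_{m\mathfrak K}}2\,Q_{n-m\mathfrak K}(x), & n\ge m\mathfrak K,\\[2mm] Q_{n+m\mathfrak K}(x)-\dfrac{h_n}2\,Q_{m\mathfrak K-n}(x), & n\le m\mathfrak K.\end{cases}$$ 3. For $1\le j\le\mathfrak K-1$, $$P_{n\mathfrak K-j}(x)=\frac1{h_j}\Big(P_{n\mathfrak K}(x)P_j(x)-\frac{Q_{n\mathfrak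 K}(x)Q_j(x)}{\psi(x)^2}\Big)\quad (x\ne\alpha_1,\dots,\alpha_g),$$ $$Q_{n\mathfrak K-j}(x)=\frac1{h_j}\big(Q_{n\mathfrak K}(x)P_j(x)-P_{n\mathfrak K}(x)Q_j(x)\big).$$ -/

import Mathlib

open MeasureTheory Polynomial

/-- The end points of the gaps of a set of bands in `[-1, 1]`:
`-1 < α₁ < β₁ < α₂ < β₂ < ⋯ < α_g < β_g < 1`. -/
structure BranchPoints (g : ℕ) where
  α : Fin g → ℝ
  β : Fin g → ℝ
  neg_one_lt : ∀ j, -1 < α j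
  left_lt_right : ∀ j, α j < β j
  right_lt_left : ∀ i j, i < j → β i < α j
  lt_one : ∀ j, β j < 1

namespace BranchPoints

variable {g : ℕ} (S : BranchPoints g)

/-- `E = [-1, α₁] ∪ [β₁, α₂] ∪ ⋯ ∪ [β_g, 1]`, that is, `[-1, 1]` without the open gaps
`(α_j, β_j)`. -/
def E : Set ℝ := Set.Icc (-1) 1 \ ⋃ j, Set.Ioo (S.α j) (S.β j)

/-- The weight function on `E`. -/
noncomputable def w (x : ℝ) : ℝ :=
  1 / Real.pi * Real.sqrt ((∏ j, (x - S.α j)) / ((1 - x ^ 2) * ∏ j, (x - S.β j)))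

/-- The inner product `∫_E p q w dx` of two real polynomials. -/
noncomputable def ip (p q : ℝ[X]) : ℝ :=
  ∫ x in S.E, p.eval x * q.eval x * S.w x

/-- The monic orthogonal polynomials of the weight `w` on `E` (the Gram–Schmidt process applied
to `1, X, X ^ 2, …`). -/
noncomputable def P (n : ℕ) : ℝ[X] :=
  X ^ n - ∑ k : Fin n, C (S.ip (X ^ n) (P k) / S.ip (P k) (P k)) * P k
termination_by n
decreasing_by exact k.isLt

/-- The squared norms `h_n = ∫_E P_n ^ 2 w dx`. -/
noncomputable def h (n : ℕ) : ℝ := S.ip (S.P n) (S.P n)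

/-- The coefficient `a_n`, `n ≥ 1`, of the three-term recurrence
`x P_n = P_{n+1} + b_{n+1} P_n + a_n P_{n-1}`. -/
noncomputable def a (n : ℕ) : ℝ := S.ip (X * S.P n) (S.P (n - 1)) / S.h (n - 1)

/-- The coefficient `b_n`, `n ≥ 1`, of the three-term recurrence
`x P_n = P_{n+1} + b_{n+1} P_n + a_n P_{n-1}`. -/
noncomputable def b (n : ℕ) : ℝ := S.ip (X * S.P (n - 1)) (S.P (n - 1)) / S.h (n - 1)

/-- The recurrence coefficients repeat with period `K`. The coefficient `a₁` is exempt: already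
for the classical Chebyshev polynomials `a₁ = 1 / 2`, while `a_n = 1 / 4` for `n ≥ 2`. -/
def HasPeriod (K : ℕ) : Prop :=
  (∀ n, 2 ≤ n → S.a (n + K) = S.a n) ∧ (∀ n, 1 ≤ n → S.b (n + K) = S.b n)

/-- The value `P_n(z)` at a complex number. -/
noncomputable def evalP (n : ℕ) (z : ℂ) : ℂ := aeval z (S.P n)

/-- The polynomials of the second kind `Q_n(z) = ∫_E (P_n(z) - P_n(t)) / (z - t) w(t) dt`. -/
noncomputable def evalQ (n : ℕ) (z : ℂ) : ℂ :=
  ∫ t in S.E, (S.evalP n z - S.evalP n (t : ℂ)) / (z - (t : ℂ)) * (S.w t : ℂ)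

open Classical in
/-- The function `ψ`: the Stieltjes transform `∫_E w(t) / (z - t) dt` of the weight off `E`, and its
boundary value from the upper half plane `(π / i) w` on `E`. (At the points `±1` and `β_j`, where
`ψ` is infinite, the value here is `0`, so that `1 / ψ ^ 2` has its correct value `0`.) -/
noncomputable def psi (z : ℂ) : ℂ :=
  if z.im = 0 ∧ z.re ∈ S.E then ((Real.pi : ℂ) / Complex.I) * (S.w z.re : ℂ)
  else ∫ t in S.E, (S.w t : ℂ) / (z - (t : ℂ))

end BranchPoints

/-!
The function `ψ = ∫_E w(t) / (z - t) dt` is the branch of `√(∏ (z - α_j) / ((z² - 1) ∏ (z - β_j)))`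
that behaves like `1 / z` at infinity: that branch has imaginary part `-π w` on `E` and is real on
the rest of the real line, so the Cauchy formula in the upper half plane turns it into the
Stieltjes transform of `w`.

The functions of the second kind `q_n = P_n ψ - Q_n` decay like `z ^ (-n - 1)`. If `M` is a period,
then `ρ q_M, q_{M+1}, q_{M+2}, …` with `ρ = a_{M+1} / a_1` solves the same recurrence as
`q_0, q_1, q_2, …`. The Casoratian of the two solutions is, up to the factor `h_n`, independent of
the index `n` at which it is taken, so it decays faster than every power. Multiplied by the
denominator of `ψ²` it has the form `u - v ψ` with polynomials `u` and `v`, and `ψ` is not rational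
because `ψ²` has a simple pole at `1`; hence `u = v = 0`. The equation `v = 0` forces `ρ = 1 / 2`
and `2 Q_{M+1} = P_1 Q_M + P_M`, and `u = 0` says that `Q_M / ψ²` is the polynomial
`2 P_{M+1} - P_1 P_M`. Since a solution is determined by its first two terms, the addition formulas
for `P_{n+M}` and `Q_{n+M}` follow, and the Casoratian of `P` and `Q` gives
`P_M² - Q_M² / ψ² = 2 h_M`.

Finally `P_j P_M - Q_j Q_M / ψ²` solves the recurrence in `j`, and its leading asymptotics at
infinity, `h_j x ^ (M - j)`, determine the coefficients of the recurrence that leads from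
`j` and `j + 1` to `j + 2`. This identifies it with `h_j P_{M-j}`.
-/

section SquareRootSingularities

open Filter Topology Asymptotics

theorem locallyIntegrable_inv_sqrt_abs_sub (e : ℝ) :
    LocallyIntegrable fun x : ℝ => (√|x - e|)⁻¹ := by
  have h0 : LocallyIntegrable fun x : ℝ => (√|x|)⁻¹ := by
    refine locallyIntegrable_of_norm_le_rpow (C := 1) (α := 1 / 2) (by simp) (by norm_num) ?_
      (Measurable.aestronglyMeasurable (by fun_prop))
    filter_upwards with x
    rw [one_mul, Real.norm_of_nonneg (by positivity), Real.norm_eq_abs,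
      Real.rpow_neg (abs_nonneg x), Real.sqrt_eq_rpow]
  refine locallyIntegrable_iff.2 fun K hK => ?_
  have h1 := (measurePreserving_sub_right volume e).integrableOn_comp_preimage
    (Homeomorph.subRight e).measurableEmbedding (f := fun x : ℝ => (√|x|)⁻¹)
    (s := (fun x => x - e) '' K)
  rw [Set.preimage_image_eq _ sub_left_injective] at h1
  exact h1.2 (h0.integrableOn_isCompact (hK.image (continuous_sub_right e)))

theorem locallyIntegrable_prod_inv_sqrt_abs_sub (s : Finset ℝ) :
    LocallyIntegrable fun x : ℝ => ∏ e ∈ s, (√|x - e|)⁻¹ := by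
  intro x₀
  have hcont : ContinuousAt (fun x : ℝ => ∏ e ∈ s.erase x₀, (√|x - e|)⁻¹) x₀ := by
    refine tendsto_finsetProd _ fun e he => ContinuousAt.inv₀ (by fun_prop) ?_
    exact (Real.sqrt_pos.2 (abs_sub_pos.2 (Finset.ne_of_mem_erase he).symm)).ne'
  have hmeas : StronglyMeasurableAtFilter (fun x : ℝ => ∏ e ∈ s, (√|x - e|)⁻¹) (𝓝 x₀) :=
    (Measurable.aestronglyMeasurable (by fun_prop)).stronglyMeasurableAtFilter
  by_cases hx₀ : x₀ ∈ s
  · refine IsBigO.integrableAtFilter ?_ hmeas (locallyIntegrable_inv_sqrt_abs_sub x₀ x₀)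
    simp_rw [← Finset.mul_prod_erase s _ hx₀]
    simpa using (isBigO_refl (fun x : ℝ => (√|x - x₀|)⁻¹) (𝓝 x₀)).mul (hcont.isBigO_one ℝ)
  · rw [Finset.erase_eq_of_notMem hx₀] at hcont
    exact (hcont.isBigO_one ℝ).integrableAtFilter hmeas (locallyIntegrable_const 1 x₀)

end SquareRootSingularities

section BoundaryValues

open Filter Topology Asymptotics Bornology UpperHalfPlane

/-- The holomorphic function `f` on the upper half plane has the boundary values `f₀` at almost
every point of the real line. The locally integrable majorant lets integrals along the lines
`Im z = ε` pass to the real line. -/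
structure HasBoundaryValues (f : ℂ → ℂ) (f₀ : ℝ → ℂ) : Prop where
  differentiableOn : DifferentiableOn ℂ f upperHalfPlaneSet
  exists_bound : ∃ B : ℝ → ℝ, LocallyIntegrable B ∧
    ∀ᶠ ε : ℝ in 𝓝[>] 0, ∀ᵐ x : ℝ, ‖f (x + ε * Complex.I)‖ ≤ B x
  tendsto : ∀ᵐ x : ℝ, Tendsto (fun ε : ℝ => f (x + ε * Complex.I)) (𝓝[>] 0) (𝓝 (f₀ x))

theorem exists_norm_le_div_sq {f : ℂ → ℂ}
    (hO : f =O[cobounded ℂ ⊓ 𝓟 upperHalfPlaneSet] fun z => (z ^ 2)⁻¹) :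
    ∃ c r : ℝ, 0 ≤ c ∧ 1 ≤ r ∧ ∀ z : ℂ, 0 < z.im → r ≤ ‖z‖ → ‖f z‖ ≤ c / ‖z‖ ^ 2 := by
  obtain ⟨c, hc, h⟩ := hO.exists_nonneg
  rw [isBigOWith_iff, eventually_inf_principal,
    (Metric.hasBasis_cobounded_compl_ball (0 : ℂ)).eventually_iff] at h
  obtain ⟨r, -, h⟩ := h
  refine ⟨c, max 1 r, hc, le_max_left _ _, fun z hz hr => ?_⟩
  simpa [div_eq_mul_inv] using
    h (x := z) (by simpa using (le_max_right _ _).trans hr) hz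

theorem norm_integral_horizontal_le {f : ℂ → ℂ} (hf : DifferentiableOn ℂ f upperHalfPlaneSet)
    {m R ε : ℝ} (hε : 0 < ε) (hεR : ε ≤ R) (hm : ∀ z : ℂ, 0 < z.im → R ≤ ‖z‖ → ‖f z‖ ≤ m) :
    ‖∫ x in (-R)..R, f (x + ε * Complex.I)‖ ≤ 4 * m * R := by
  have hrect := Complex.integral_boundary_rect_eq_zero_of_differentiableOn f ⟨-R, ε⟩ ⟨R, R⟩
    (hf.mono fun z hz => by
      have := hz.2
      rw [Set.mem_preimage, Set.uIcc_of_le hεR] at this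
      exact hε.trans_le this.1)
  have htop : ‖∫ x in (-R)..R, f (x + R * Complex.I)‖ ≤ m * |R - -R| := by
    refine intervalIntegral.norm_integral_le_of_norm_le_const fun x _ => hm _ ?_ ?_
    · simpa using hε.trans_le hεR
    · exact (le_abs_self R).trans (by simpa using Complex.abs_im_le_norm (x + R * Complex.I))
  have hside (s : ℝ) (hs : |s| = R) : ‖∫ y in ε..R, f (s + y * Complex.I)‖ ≤ m * |R - ε| := by
    refine intervalIntegral.norm_integral_le_of_norm_le_const fun y hy => hm _ ?_ ?_
    · rw [Set.uIoc_of_le hεR] at hy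
      simpa using hε.trans hy.1
    · simpa [hs] using Complex.abs_re_le_norm (s + y * Complex.I)
  have hright := hside R (abs_of_pos (hε.trans_le hεR))
  have hleft := hside (-R) (by rw [abs_neg, abs_of_pos (hε.trans_le hεR)])
  have hm0 : 0 ≤ m := (norm_nonneg _).trans
    (hm (R * Complex.I) (by simpa using hε.trans_le hεR) (by simpa using le_abs_self R))
  have hbottom : ∫ x in (-R)..R, f (x + ε * Complex.I) =
      (∫ x in (-R)..R, f (x + R * Complex.I)) -
        Complex.I • (∫ y in ε..R, f (R + y * Complex.I)) +
        Complex.I • (∫ y in ε..R, f ((-R : ℝ) + y * Complex.I)) := by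
    linear_combination hrect
  rw [hbottom]
  refine (norm_add_le _ _).trans ((add_le_add_left (norm_sub_le _ _) _).trans ?_)
  rw [norm_smul, norm_smul, Complex.norm_I, one_mul, one_mul]
  rw [abs_of_nonneg (by linarith)] at hright hleft htop
  nlinarith

theorem integral_horizontal_eq_zero {f : ℂ → ℂ} (hf : DifferentiableOn ℂ f upperHalfPlaneSet)
    (hO : f =O[cobounded ℂ ⊓ 𝓟 upperHalfPlaneSet] fun z => (z ^ 2)⁻¹) {ε : ℝ} (hε : 0 < ε)
    (hi : Integrable fun x : ℝ => f (x + ε * Complex.I)) :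
    ∫ x : ℝ, f (x + ε * Complex.I) = 0 := by
  obtain ⟨c, r, hc, -, hdecay⟩ := exists_norm_le_div_sq hO
  refine tendsto_nhds_unique
    (intervalIntegral_tendsto_integral hi tendsto_neg_atTop_atBot tendsto_id) ?_
  refine squeeze_zero_norm' (a := fun R => 4 * c / R) ?_ (tendsto_const_nhds.div_atTop tendsto_id)
  filter_upwards [eventually_ge_atTop r, eventually_ge_atTop ε] with R hrR hεR
  have hR : 0 < R := hε.trans_le hεR
  refine (norm_integral_horizontal_le hf hε hεR (m := c / R ^ 2) fun z hz hzR => ?_).trans_eq ?_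
  · exact (hdecay z hz (hrR.trans hzR)).trans (by gcongr)
  · field_simp

namespace HasBoundaryValues

variable {f : ℂ → ℂ} {f₀ : ℝ → ℂ}

theorem exists_integrable_bound (h : HasBoundaryValues f f₀)
    (hO : f =O[cobounded ℂ ⊓ 𝓟 upperHalfPlaneSet] fun z => (z ^ 2)⁻¹) :
    ∃ G : ℝ → ℝ, Integrable G ∧
      ∀ᶠ ε : ℝ in 𝓝[>] 0, ∀ᵐ x : ℝ, ‖f (x + ε * Complex.I)‖ ≤ G x := by
  obtain ⟨B, hB, hfB⟩ := h.exists_bound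
  obtain ⟨c, r, hc, hr, hdecay⟩ := exists_norm_le_div_sq hO
  refine ⟨fun x => (Set.Icc (-r) r).indicator B x + 2 * c * (1 + x ^ 2)⁻¹,
    ((hB.integrableOn_isCompact isCompact_Icc).integrable_indicator measurableSet_Icc).add
      (integrable_inv_one_add_sq.const_mul _), ?_⟩
  filter_upwards [hfB, self_mem_nhdsWithin] with ε hεB hε
  filter_upwards [hεB] with x hx
  by_cases hxr : x ∈ Set.Icc (-r) r
  · rw [Set.indicator_of_mem hxr]
    exact hx.trans (le_add_of_nonneg_right (by positivity))
  · rw [Set.indicator_of_notMem hxr, zero_add]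
    have hrx : r < |x| := lt_of_not_ge fun hle => hxr (abs_le.1 hle)
    have hxz : |x| ≤ ‖(x : ℂ) + ε * Complex.I‖ := by
      simpa using Complex.abs_re_le_norm (x + ε * Complex.I)
    refine (hdecay _ (by simpa using hε) (hrx.le.trans hxz)).trans ?_
    have hx2 : 1 + x ^ 2 ≤ 2 * ‖(x : ℂ) + ε * Complex.I‖ ^ 2 := by
      nlinarith [sq_abs x]
    rw [← div_eq_mul_inv, div_le_div_iff₀ (by nlinarith) (by positivity)]
    nlinarith

theorem integrable (h : HasBoundaryValues f f₀)
    (hO : f =O[cobounded ℂ ⊓ 𝓟 upperHalfPlaneSet] fun z => (z ^ 2)⁻¹) : Integrable f₀ := by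
  obtain ⟨G, hG, hfG⟩ := h.exists_integrable_bound hO
  obtain ⟨u, hu⟩ := exists_seq_tendsto (𝓝[>] (0 : ℝ))
  obtain ⟨N, hN⟩ := eventually_atTop.1 (hu.eventually (hfG.and self_mem_nhdsWithin))
  have hlim : ∀ᵐ x : ℝ, Tendsto (fun n => f (x + u (n + N) * Complex.I)) atTop (𝓝 (f₀ x)) :=
    h.tendsto.mono fun x hx => hx.comp (hu.comp (tendsto_add_atTop_nat N))
  refine ⟨aestronglyMeasurable_of_tendsto_ae atTop (fun n => ?_) hlim,
    hasFiniteIntegral_of_dominated_convergence hG.2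
      (fun n => (hN (n + N) (Nat.le_add_left N n)).1) hlim⟩
  refine (h.differentiableOn.continuousOn.comp_continuous (by fun_prop) fun x => ?_)
    |>.aestronglyMeasurable
  simpa using (hN (n + N) (Nat.le_add_left N n)).2

theorem integral_eq_zero (h : HasBoundaryValues f f₀)
    (hO : f =O[cobounded ℂ ⊓ 𝓟 upperHalfPlaneSet] fun z => (z ^ 2)⁻¹) : ∫ x, f₀ x = 0 := by
  obtain ⟨G, hG, hfG⟩ := h.exists_integrable_bound hO
  have hmeas : ∀ᶠ ε : ℝ in 𝓝[>] 0,
      AEStronglyMeasurable (fun x : ℝ => f (x + ε * Complex.I)) volume := by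
    filter_upwards [self_mem_nhdsWithin] with ε hε
    exact (h.differentiableOn.continuousOn.comp_continuous (by fun_prop) fun x => by
      simpa using hε).aestronglyMeasurable
  refine tendsto_nhds_unique
    (tendsto_integral_filter_of_dominated_convergence G hmeas hfG hG h.tendsto)
    (tendsto_const_nhds.congr' ?_)
  filter_upwards [hfG, hmeas, self_mem_nhdsWithin] with ε hεG hεm hε
  exact (integral_horizontal_eq_zero h.differentiableOn hO hε (hG.mono' hεm hεG)).symm

end HasBoundaryValues

theorem abs_sub_im_le_norm (x ε : ℝ) (c : ℂ) : |ε - c.im| ≤ ‖(x : ℂ) + ε * Complex.I - c‖ := by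
  simpa using Complex.abs_im_le_norm ((x : ℂ) + ε * Complex.I - c)

theorem ofReal_sub_ne_zero (x : ℝ) {c : ℂ} (hc : c.im ≠ 0) : (x : ℂ) - c ≠ 0 := fun h =>
  hc (by simpa using congrArg Complex.im h)

theorem tendsto_add_mul_I_sub (x : ℝ) (c : ℂ) :
    Tendsto (fun ε : ℝ => (x : ℂ) + ε * Complex.I - c) (𝓝[>] 0) (𝓝 (x - c)) :=
  tendsto_nhdsWithin_of_tendsto_nhds
    (Continuous.tendsto' (by fun_prop) _ _ (by simp))

theorem isBigO_inv_sub (c : ℂ) : (fun z : ℂ => (z - c)⁻¹) =O[cobounded ℂ] fun z => z⁻¹ := by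
  refine IsBigO.inv_rev (IsBigO.of_bound 2 ?_) ?_
  · filter_upwards [tendsto_norm_cobounded_atTop.eventually_ge_atTop (2 * ‖c‖)] with z hz
    linarith [norm_sub_norm_le z c]
  · filter_upwards [eventually_ne_cobounded (0 : ℂ)] with z hz h
    exact absurd h hz

namespace HasBoundaryValues

variable {f : ℂ → ℂ} {f₀ : ℝ → ℂ}

theorem div_sub_const (h : HasBoundaryValues f f₀) {c : ℂ} (hc : c.im < 0) :
    HasBoundaryValues (fun z => f z / (z - c)) fun x => f₀ x / (x - c) where
  differentiableOn := h.differentiableOn.div (by fun_prop) fun z hz hzc => by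
    have him := congrArg Complex.im hzc
    rw [Complex.sub_im, Complex.zero_im] at him
    linarith [show 0 < z.im from hz]
  exists_bound := by
    obtain ⟨B, hB, hfB⟩ := h.exists_bound
    refine ⟨fun x => (-c.im)⁻¹ * B x, hB.smul (-c.im)⁻¹, ?_⟩
    filter_upwards [hfB, self_mem_nhdsWithin] with ε hεB (hε : 0 < ε)
    filter_upwards [hεB] with x hx
    have hle : -c.im ≤ ‖(x : ℂ) + ε * Complex.I - c‖ :=
      (by linarith : -c.im ≤ ε - c.im).trans ((le_abs_self _).trans (abs_sub_im_le_norm x ε c))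
    rw [norm_div, div_eq_inv_mul]
    exact mul_le_mul (inv_anti₀ (by linarith) hle) hx (norm_nonneg _) (by
      simpa using hc.le)
  tendsto := h.tendsto.mono fun x hx =>
    hx.div (tendsto_add_mul_I_sub x c) (ofReal_sub_ne_zero x hc.ne)

theorem dslope (h : HasBoundaryValues f f₀) {z₀ : ℂ} (hz₀ : 0 < z₀.im) :
    HasBoundaryValues (dslope f z₀) fun x => (f₀ x - f z₀) / (x - z₀) := by
  have hsmall : ∀ᶠ ε : ℝ in 𝓝[>] 0, ∀ x : ℝ,
      z₀.im / 2 ≤ ‖(x : ℂ) + ε * Complex.I - z₀‖ := by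
    filter_upwards [Ioo_mem_nhdsGT (half_pos hz₀)] with ε hε x
    exact (by linarith [hε.2] : z₀.im / 2 ≤ z₀.im - ε).trans
      ((le_abs_self _).trans (abs_sub_comm ε z₀.im ▸ abs_sub_im_le_norm x ε z₀))
  have heq : ∀ᶠ ε : ℝ in 𝓝[>] 0, ∀ x : ℝ, _root_.dslope f z₀ (x + ε * Complex.I) =
      (f (x + ε * Complex.I) - f z₀) / (x + ε * Complex.I - z₀) := by
    filter_upwards [hsmall] with ε hε x
    rw [dslope_of_ne _ (sub_ne_zero.1 (norm_pos_iff.1 ((half_pos hz₀).trans_le (hε x)))),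
      slope_def_field]
  refine ⟨(Complex.differentiableOn_dslope (isOpen_upperHalfPlaneSet.mem_nhds hz₀)).2
    h.differentiableOn, ?_, ?_⟩
  · obtain ⟨B, hB, hfB⟩ := h.exists_bound
    refine ⟨fun x => (z₀.im / 2)⁻¹ * (B x + ‖f z₀‖),
      (hB.add (locallyIntegrable_const _)).smul (z₀.im / 2)⁻¹, ?_⟩
    filter_upwards [hfB, hsmall, heq] with ε hεB hε hεeq
    filter_upwards [hεB] with x hx
    rw [hεeq, norm_div, div_eq_inv_mul]
    exact mul_le_mul (inv_anti₀ (half_pos hz₀) (hε x))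
      ((norm_sub_le _ _).trans (by gcongr)) (norm_nonneg _) (by positivity)
  · filter_upwards [h.tendsto] with x hx
    exact ((hx.sub_const _).div (tendsto_add_mul_I_sub x z₀)
      (ofReal_sub_ne_zero x hz₀.ne')).congr' (heq.mono fun ε hε => (hε x).symm)

theorem integrable_and_integral_div_sub_conj (h : HasBoundaryValues f f₀)
    (hO : f =O[cobounded ℂ ⊓ 𝓟 upperHalfPlaneSet] fun z => z⁻¹) {z₀ : ℂ} (hz₀ : 0 < z₀.im) :
    Integrable (fun x : ℝ => f₀ x / (x - (starRingEnd ℂ) z₀)) ∧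
      ∫ x : ℝ, f₀ x / (x - (starRingEnd ℂ) z₀) = 0 := by
  have hdiv := h.div_sub_const (c := (starRingEnd ℂ) z₀) (by simpa using hz₀)
  have hO2 : (fun z => f z / (z - (starRingEnd ℂ) z₀))
      =O[cobounded ℂ ⊓ 𝓟 upperHalfPlaneSet] fun z => (z ^ 2)⁻¹ := by
    simpa only [div_eq_mul_inv, sq, mul_inv] using
      hO.mul ((isBigO_inv_sub _).mono inf_le_left)
  exact ⟨hdiv.integrable hO2, hdiv.integral_eq_zero hO2⟩

end HasBoundaryValues

theorem isBigO_dslope {f : ℂ → ℂ} {l : Filter ℂ} (hl : l ≤ cobounded ℂ)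
    (hO : f =O[l] fun z => z⁻¹) (z₀ : ℂ) : dslope f z₀ =O[l] fun z => z⁻¹ := by
  have hsub : (fun z => f z - f z₀) =O[l] fun _ => (1 : ℂ) :=
    (hO.trans ((tendsto_inv₀_cobounded.mono_left hl).isBigO_one ℂ)).sub
      (isBigO_const_const _ one_ne_zero _)
  refine IsBigO.congr' (hsub.mul ((isBigO_inv_sub z₀).mono hl)) ?_ (by simp)
  filter_upwards [hl (eventually_ne_cobounded z₀)] with z hz
  rw [dslope_of_ne _ hz, slope_def_field, div_eq_mul_inv]

theorem integrable_inv_sq_add_sq (a : ℝ) {b : ℝ} (hb : 0 < b) :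
    Integrable fun x : ℝ => ((x - a) ^ 2 + b ^ 2)⁻¹ := by
  refine (((integrable_inv_one_add_sq.comp_div hb.ne').comp_sub_right a).const_mul
    (b ^ 2)⁻¹).congr (.of_forall fun x => ?_)
  simp only
  field_simp
  ring

theorem integral_inv_sub_sq_add_sq (a : ℝ) {b : ℝ} (hb : 0 < b) :
    ∫ x : ℝ, ((x - a) ^ 2 + b ^ 2)⁻¹ = Real.pi / b := by
  have hscale (x : ℝ) : ((x - a) ^ 2 + b ^ 2)⁻¹ = (b ^ 2)⁻¹ * (1 + ((x - a) / b) ^ 2)⁻¹ := by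
    field_simp
    ring
  simp_rw [hscale]
  rw [integral_const_mul, integral_sub_right_eq_self (fun x => (1 + (x / b) ^ 2)⁻¹) a,
    Measure.integral_comp_div (fun x => (1 + x ^ 2)⁻¹) b, integral_univ_inv_one_add_sq,
    abs_of_pos hb, smul_eq_mul]
  field_simp

theorem ofReal_im_div_sub (w v : ℂ) (x : ℝ) {z₀ : ℂ} (hz₀ : z₀.im ≠ 0) :
    (w.im : ℂ) / (x - z₀) = ((w / (x - (starRingEnd ℂ) z₀)).im : ℂ) +
      z₀.im * ((w - v) / (x - z₀) / (x - (starRingEnd ℂ) z₀)) +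
      z₀.im * v * (((x - z₀.re) ^ 2 + z₀.im ^ 2)⁻¹ : ℝ) := by
  have hne := ofReal_sub_ne_zero x hz₀
  have hne' := ofReal_sub_ne_zero x (c := (starRingEnd ℂ) z₀) (by simpa using hz₀)
  have hnorm : (((x - z₀.re) ^ 2 + z₀.im ^ 2 : ℝ) : ℂ) =
      (x - z₀) * (x - (starRingEnd ℂ) z₀) := by
    apply Complex.ext
    · simp [sq]
    · simp [sq]
      ring
  have him (u : ℂ) : (u.im : ℂ) = (u - (starRingEnd ℂ) u) / (2 * Complex.I) := by
    rw [Complex.sub_conj]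
    field_simp
    push_cast
    ring
  rw [Complex.ofReal_inv, hnorm, him, him (w / _), him z₀]
  simp only [map_div₀, map_sub, Complex.conj_conj, Complex.conj_ofReal]
  field_simp
  ring

-- Adding the Cauchy formula for the point `conj z₀` outside the half plane cancels the real part
-- of the boundary values; the constant `f z₀` is carried by the Poisson kernel.
theorem HasBoundaryValues.integral_im_div_sub {f : ℂ → ℂ} {f₀ : ℝ → ℂ}
    (h : HasBoundaryValues f f₀)
    (hO : f =O[cobounded ℂ ⊓ 𝓟 upperHalfPlaneSet] fun z => z⁻¹) {z₀ : ℂ} (hz₀ : 0 < z₀.im) :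
    ∫ x : ℝ, ((f₀ x).im : ℂ) / (x - z₀) = Real.pi * f z₀ := by
  obtain ⟨hi₁, h₁⟩ := h.integrable_and_integral_div_sub_conj hO hz₀
  obtain ⟨hi₂, h₂⟩ := (h.dslope hz₀).integrable_and_integral_div_sub_conj
    (isBigO_dslope inf_le_left hO z₀) hz₀
  have hi₁' : Integrable fun x : ℝ => ((f₀ x / (x - (starRingEnd ℂ) z₀)).im : ℂ) := hi₁.im.ofReal
  have hi₂' := hi₂.const_mul (z₀.im : ℂ)
  have hi₃ : Integrable fun x : ℝ =>
      z₀.im * f z₀ * (((x - z₀.re) ^ 2 + z₀.im ^ 2)⁻¹ : ℝ) :=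
    (integrable_inv_sq_add_sq z₀.re hz₀).ofReal.const_mul (z₀.im * f z₀)
  have him₁ : ∫ x : ℝ, (f₀ x / (x - (starRingEnd ℂ) z₀)).im = 0 := by
    exact (integral_im hi₁).trans (congrArg Complex.im h₁)
  have hz₀' : (z₀.im : ℂ) ≠ 0 := by exact_mod_cast hz₀.ne'
  simp_rw [fun x => ofReal_im_div_sub (f₀ x) (f z₀) x hz₀.ne']
  refine (integral_add (hi₁'.add hi₂') hi₃).trans ?_
  rw [Pi.add_def, integral_add hi₁' hi₂', integral_const_mul, integral_const_mul, h₂,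
    integral_complex_ofReal, him₁, integral_complex_ofReal, integral_inv_sub_sq_add_sq _ hz₀]
  push_cast
  field_simp
  ring

end BoundaryValues

section ComplexSqrt

theorem complexSqrt_sq (z : ℂ) : z.sqrt ^ 2 = z := by
  simp [Complex.sqrt]

theorem norm_complexSqrt (z : ℂ) : ‖z.sqrt‖ = √‖z‖ := by
  rw [eq_comm, Real.sqrt_eq_iff_eq_sq (norm_nonneg _) (norm_nonneg _), ← norm_pow, complexSqrt_sq]

theorem complexSqrt_ne_zero {z : ℂ} (hz : z ≠ 0) : z.sqrt ≠ 0 :=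
  ne_zero_of_norm_ne_zero (by rw [norm_complexSqrt]; positivity)

theorem differentiableAt_complexSqrt {z : ℂ} (hz : z ∈ Complex.slitPlane) :
    DifferentiableAt ℂ Complex.sqrt z :=
  differentiableAt_id.cpow_const hz

theorem continuousOn_complexSqrt : ContinuousOn Complex.sqrt {z | 0 ≤ z.im} := by
  refine ContinuousOn.congr (f := fun z : ℂ =>
    (√((‖z‖ + z.re) / 2) + √((‖z‖ - z.re) / 2) * Complex.I : ℂ)) (by fun_prop) fun z hz => ?_
  rw [Complex.sqrt_eq_real_add_ite, if_pos (Set.mem_ofPred.1 hz), one_mul]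

open ComplexOrder in
theorem complexSqrt_ofReal {x : ℝ} (hx : 0 ≤ x) : (x : ℂ).sqrt = √x := by
  simpa using Complex.sqrt_of_nonneg (a := (x : ℂ)) (by exact_mod_cast hx)

open ComplexOrder in
theorem complexSqrt_ofReal_of_nonpos {x : ℝ} (hx : x ≤ 0) :
    (x : ℂ).sqrt = Complex.I * √(-x) := by
  have h := Complex.sqrt_neg_of_nonneg (a := ((-x : ℝ) : ℂ))
    (by exact_mod_cast neg_nonneg.2 hx)
  rwa [complexSqrt_ofReal (by linarith), Complex.ofReal_neg, neg_neg] at h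

theorem complexSqrt_div_complexSqrt {x y : ℝ} (h : 0 < x / y) :
    (x : ℂ).sqrt / (y : ℂ).sqrt = √(x / y) := by
  rcases div_pos_iff.1 h with ⟨hx, hy⟩ | ⟨hx, hy⟩
  · rw [complexSqrt_ofReal hx.le, complexSqrt_ofReal hy.le, Real.sqrt_div hx.le,
      Complex.ofReal_div]
  · rw [complexSqrt_ofReal_of_nonpos hx.le, complexSqrt_ofReal_of_nonpos hy.le,
      mul_div_mul_left _ _ Complex.I_ne_zero, ← neg_div_neg_eq x y,
      Real.sqrt_div (neg_nonneg.2 hx.le), Complex.ofReal_div]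

end ComplexSqrt

theorem aeval_complex_ofReal (p : ℝ[X]) (x : ℝ) : aeval (x : ℂ) p = ((p.eval x : ℝ) : ℂ) :=
  aeval_ofReal p x

theorem two_mul_C_one_div_two {F : Type*} [Field F] [NeZero (2 : F)] :
    (2 : F[X]) * C (1 / 2) = 1 := by
  rw [← C_ofNat, ← C_mul, mul_one_div_cancel two_ne_zero, C_1]

section JacobiRecurrence

variable {F A B : Type*} [CommRing F] [CommRing A] [Algebra F A] [CommRing B] [Algebra F B]

/-- The sequence `y` solves the three-term recurrence with coefficients `a`, `b` and spectral
parameter `x`. The indices follow the convention `x y_n = y_{n+1} + b_{n+1} y_n + a_n y_{n-1}`. -/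
def IsJacobiSolution (a b : ℕ → F) (x : A) (y : ℕ → A) : Prop :=
  ∀ n, y (n + 2) = x * y (n + 1) - b (n + 2) • y (n + 1) - a (n + 1) • y n

/-- The Casoratian (discrete Wronskian) of two sequences. -/
def casoratian (y z : ℕ → A) (n : ℕ) : A := y n * z (n + 1) - y (n + 1) * z n

/-- The shift by `M` of a sequence, with its initial value rescaled by `ρ`. It takes solutions of a
recurrence to solutions if `b` has period `M` and `a` has period `M` up to `a_{M+1} = ρ a_1`. -/
def rescaledShift (ρ : F) (M : ℕ) (y : ℕ → A) : ℕ → A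
  | 0 => ρ • y M
  | n + 1 => y (n + 1 + M)

namespace IsJacobiSolution

variable {a b : ℕ → F} {x : A} {y z : ℕ → A}

theorem add (hy : IsJacobiSolution a b x y) (hz : IsJacobiSolution a b x z) :
    IsJacobiSolution a b x fun n => y n + z n := fun n => by
  simp only [hy n, hz n, smul_add]
  ring

theorem sub (hy : IsJacobiSolution a b x y) (hz : IsJacobiSolution a b x z) :
    IsJacobiSolution a b x fun n => y n - z n := fun n => by
  simp only [hy n, hz n, smul_sub]
  ring

theorem mul_const (hy : IsJacobiSolution a b x y) (c : A) :
    IsJacobiSolution a b x fun n => y n * c := fun n => by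
  simp only [hy n, Algebra.smul_def]
  ring

theorem map (hy : IsJacobiSolution a b x y) (f : A →ₐ[F] B) :
    IsJacobiSolution a b (f x) fun n => f (y n) := fun n => by
  simp only [hy n, map_sub, map_mul, map_smul]

theorem ext (hy : IsJacobiSolution a b x y) (hz : IsJacobiSolution a b x z) (h0 : y 0 = z 0)
    (h1 : y 1 = z 1) (n : ℕ) : y n = z n := by
  induction n using Nat.twoStepInduction with
  | zero => exact h0
  | one => exact h1
  | more n ih0 ih1 => rw [hy n, hz n, ih0, ih1]

theorem shift {ρ : F} {M : ℕ} (hy : IsJacobiSolution a b x y) (hρ : a (M + 1) = ρ * a 1)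
    (ha : ∀ n, 2 ≤ n → a (n + M) = a n) (hb : ∀ n, 2 ≤ n → b (n + M) = b n) :
    IsJacobiSolution a b x (rescaledShift ρ M y)
  | 0 => by
    have h := hy M
    rw [add_comm M 2, hb 2 le_rfl, hρ, mul_comm ρ, mul_smul, add_comm M 1] at h
    exact h
  | n + 1 => by
    have h := hy (n + 1 + M)
    rw [show n + 1 + M + 2 = n + 3 + M by ring, show n + 1 + M + 1 = n + 2 + M by ring,
      hb _ (by omega), ha _ (by omega)] at h
    exact h

theorem casoratian_succ (hy : IsJacobiSolution a b x y) (hz : IsJacobiSolution a b x z) (n : ℕ) :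
    casoratian y z (n + 1) = a (n + 1) • casoratian y z n := by
  simp only [casoratian, hy n, hz n, Algebra.smul_def]
  ring

theorem casoratian_eq_smul {c : ℕ → F} (hc₀ : c 0 = 1) (hc : ∀ n, c (n + 1) = a (n + 1) * c n)
    (hy : IsJacobiSolution a b x y) (hz : IsJacobiSolution a b x z) (n : ℕ) :
    casoratian y z n = c n • casoratian y z 0 := by
  induction n with
  | zero => rw [hc₀, one_smul]
  | succ n ih => rw [hy.casoratian_succ hz, ih, hc, mul_smul]

end IsJacobiSolution

end JacobiRecurrence

section OrthogonalPolynomials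

variable {F : Type*} [CommRing F]

theorem degree_sub_C_coeff_mul_lt {n : ℕ} {p q : F[X]} (hp : p.natDegree ≤ n)
    (hq : q.Monic) (hqn : q.natDegree = n) : (p - C (p.coeff n) * q).degree < n := by
  refine (degree_lt_iff_coeff_zero _ _).2 fun m hm => ?_
  rcases hm.eq_or_lt with rfl | hm
  · rw [coeff_sub, coeff_C_mul, ← hqn, hq.coeff_natDegree, mul_one, sub_self]
  · rw [coeff_sub, coeff_C_mul, coeff_eq_zero_of_natDegree_lt (hp.trans_lt hm),
      coeff_eq_zero_of_natDegree_lt (hqn.trans_lt hm), mul_zero, sub_self]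

/-- The polynomials `P n` are the monic orthogonal polynomials of the moment functional `L`. -/
structure IsMonicOrthogonal (L : F[X] →ₗ[F] F) (P : ℕ → F[X]) : Prop where
  monic : ∀ n, (P n).Monic
  natDegree_eq : ∀ n, (P n).natDegree = n
  map_mul_eq_zero : ∀ {m n}, m < n → L (P n * P m) = 0

namespace IsMonicOrthogonal

variable {L : F[X] →ₗ[F] F} {P : ℕ → F[X]} (hP : IsMonicOrthogonal L P)

include hP

theorem degree_sub_coeff_mul_lt {n : ℕ} {p : F[X]} (hp : p.natDegree ≤ n) :
    (p - C (p.coeff n) * P n).degree < n :=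
  degree_sub_C_coeff_mul_lt hp (hP.monic n) (hP.natDegree_eq n)

theorem map_mul_eq_zero_of_degree_lt {n : ℕ} {p : F[X]} (hp : p.degree < n) : L (P n * p) = 0 := by
  suffices key : ∀ k ≤ n, ∀ p : F[X], p.degree < k → L (P n * p) = 0 from key n le_rfl p hp
  intro k hk
  induction k with
  | zero =>
    intro p hp
    rw [show p = 0 by simpa using hp, mul_zero, map_zero]
  | succ k ih =>
    intro p hp
    have hlower := ih (Nat.le_of_lt hk) _
      (hP.degree_sub_coeff_mul_lt
        (natDegree_le_iff_coeff_eq_zero.2 ((degree_lt_iff_coeff_zero _ _).1 hp)))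
    rwa [mul_sub, map_sub, mul_left_comm, ← smul_eq_C_mul, map_smul, hP.map_mul_eq_zero hk,
      smul_zero, sub_zero] at hlower

theorem map_mul_eq_coeff_mul {n : ℕ} {p : F[X]} (hp : p.natDegree ≤ n) :
    L (P n * p) = p.coeff n * L (P n * P n) := by
  have h := hP.map_mul_eq_zero_of_degree_lt (hP.degree_sub_coeff_mul_lt hp)
  rwa [mul_sub, map_sub, mul_left_comm, ← smul_eq_C_mul, map_smul, sub_eq_zero] at h

theorem eq_of_forall_map_mul_eq_zero [NoZeroDivisors F] (hne : ∀ n, L (P n * P n) ≠ 0)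
    {n : ℕ} {p q : F[X]} (hpq : (p - q).degree < n) (h : ∀ k < n, L (P k * p) = L (P k * q)) :
    p = q := by
  rw [← sub_eq_zero]
  by_contra hd
  have hk := h (p - q).natDegree ((natDegree_lt_iff_degree_lt hd).2 hpq)
  rw [← sub_eq_zero, ← map_sub, ← mul_sub, hP.map_mul_eq_coeff_mul le_rfl] at hk
  exact mul_ne_zero (leadingCoeff_ne_zero.2 hd) (hne _) hk

theorem mem_degreeLT {m n : ℕ} (h : m < n) : P m ∈ degreeLT F n :=
  Polynomial.mem_degreeLT.2 (degree_le_natDegree.trans_lt (by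
    rw [hP.natDegree_eq]
    exact_mod_cast h))

theorem natDegree_X_mul_le (n : ℕ) : (X * P n).natDegree ≤ n + 1 := by
  refine natDegree_mul_le.trans ?_
  rw [hP.natDegree_eq, add_comm]
  exact Nat.add_le_add_left natDegree_X_le n

theorem coeff_self (n : ℕ) : (P n).coeff n = 1 := by
  simpa only [hP.natDegree_eq] using (hP.monic n).coeff_natDegree

theorem map_mul_X_mul (n : ℕ) : L (P n * (X * P (n + 1))) = L (P (n + 1) * P (n + 1)) := by
  rw [← mul_assoc, mul_comm, mul_comm (P n), hP.map_mul_eq_coeff_mul (hP.natDegree_X_mul_le n),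
    coeff_X_mul, hP.coeff_self, one_mul]

theorem sub_X_mul_mem_degreeLT (n : ℕ) : P (n + 1) - X * P n ∈ degreeLT F (n + 1) := by
  have h := hP.degree_sub_coeff_mul_lt (hP.natDegree_X_mul_le n)
  rwa [coeff_X_mul, hP.coeff_self, C_1, one_mul, ← Polynomial.mem_degreeLT, ← neg_mem_iff,
    neg_sub] at h

theorem zero_eq_one : P 0 = 1 := (hP.monic 0).natDegree_eq_zero.1 (hP.natDegree_eq 0)

theorem one_eq [NoZeroDivisors F] (hL : L 1 ≠ 0) {b : F} (hb : b * L 1 = L X) :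
    P 1 = X - C b := by
  obtain h := (hP.monic 1).eq_X_add_C (hP.natDegree_eq 1)
  have horth := hP.map_mul_eq_zero one_pos
  rw [hP.zero_eq_one, mul_one, h, map_add, ← mul_one (C _), ← smul_eq_C_mul, map_smul, ← hb,
    smul_eq_mul, ← add_mul] at horth
  rw [h, eq_neg_of_add_eq_zero_right ((mul_eq_zero.1 horth).resolve_right hL), C_neg,
    sub_eq_add_neg]

theorem recurrence [NoZeroDivisors F] (hne : ∀ n, L (P n * P n) ≠ 0) {a b : ℕ → F}
    (ha : ∀ n, a (n + 1) * L (P n * P n) = L (P (n + 1) * P (n + 1)))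
    (hb : ∀ n, b (n + 1) * L (P n * P n) = L (P n * (X * P n))) : IsJacobiSolution a b X P := by
  intro n
  refine hP.eq_of_forall_map_mul_eq_zero hne (n := n + 2) ?_ fun k hk => ?_
  · rw [← Polynomial.mem_degreeLT, sub_sub, ← sub_add]
    exact add_mem (hP.sub_X_mul_mem_degreeLT (n + 1))
      (add_mem (Submodule.smul_mem _ _ (hP.mem_degreeLT (by omega)))
        (Submodule.smul_mem _ _ (hP.mem_degreeLT (by omega))))
  · rw [mul_comm, hP.map_mul_eq_zero hk, mul_sub, mul_sub, mul_smul_comm, mul_smul_comm, map_sub,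
      map_sub, map_smul, map_smul, smul_eq_mul, smul_eq_mul]
    rcases lt_trichotomy k n with hkn | rfl | hkn
    · have hX : (X * P k).degree < ((n + 1 : ℕ) : WithBot ℕ) :=
        degree_le_natDegree.trans_lt (by
          exact_mod_cast (hP.natDegree_X_mul_le k).trans_lt (by omega))
      rw [mul_left_comm, ← mul_assoc, mul_comm, hP.map_mul_eq_zero_of_degree_lt hX, mul_comm (P k),
        mul_comm (P k), hP.map_mul_eq_zero hkn, hP.map_mul_eq_zero (hkn.trans n.lt_succ_self)]
      simp
    · rw [hP.map_mul_X_mul, ha, mul_comm (P k), hP.map_mul_eq_zero k.lt_succ_self]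
      ring
    · obtain rfl : k = n + 1 := by omega
      rw [← hb, hP.map_mul_eq_zero n.lt_succ_self]
      ring

theorem isJacobiSolution_of_map_X_mul {A : Type*} [CommRing A] [Algebra F A] {a b : ℕ → F}
    (hrec : IsJacobiSolution a b X P) {T : F[X] → A} (hT : IsLinearMap F T) {x e : A}
    (hX : ∀ p, T (X * p) = x * T p + L p • e) : IsJacobiSolution a b x fun n => T (P n) := by
  intro n
  have hL : L (P (n + 1)) = 0 := by
    simpa [hP.zero_eq_one] using hP.map_mul_eq_zero n.succ_pos
  simp only [hrec n, hT.map_sub, hT.map_smul, hX, hL, zero_smul, add_zero]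

end IsMonicOrthogonal

end OrthogonalPolynomials

namespace BranchPoints

variable {g : ℕ} (S : BranchPoints g)

theorem neg_one_lt_β (j : Fin g) : -1 < S.β j := (S.neg_one_lt j).trans (S.left_lt_right j)

theorem α_lt_one (j : Fin g) : S.α j < 1 := (S.left_lt_right j).trans (S.lt_one j)

theorem β_lt_β {i j : Fin g} (h : i < j) : S.β i < S.β j :=
  (S.right_lt_left i j h).trans (S.left_lt_right j)

theorem β_strictMono : StrictMono S.β := fun _ _ => S.β_lt_β

theorem isCompact_E : IsCompact S.E :=
  isCompact_Icc.diff (isOpen_iUnion fun _ => isOpen_Ioo)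

theorem measurableSet_E : MeasurableSet S.E := S.isCompact_E.measurableSet

theorem mem_E_iff {x : ℝ} :
    x ∈ S.E ↔ x ∈ Set.Icc (-1) 1 ∧ ∀ j, x ∉ Set.Ioo (S.α j) (S.β j) := by
  simp [E]

theorem eq_of_mem_gap {x : ℝ} {i j : Fin g} (hi : x ∈ Set.Ioo (S.α i) (S.β i))
    (hj : x ∈ Set.Ioo (S.α j) (S.β j)) : i = j := by
  by_contra hij
  rcases lt_or_gt_of_ne hij with h | h
  · linarith [S.right_lt_left _ _ h, hi.2, hj.1]
  · linarith [S.right_lt_left _ _ h, hi.1, hj.2]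

/-- The end points `±1, β₁, …, β_g` of the bands, at which the weight is infinite. -/
noncomputable def poles : Finset ℝ := insert 1 (insert (-1) (Finset.univ.image S.β))

/-- All end points of the bands. -/
noncomputable def ends : Finset ℝ := S.poles ∪ Finset.univ.image S.α

theorem mem_poles {x : ℝ} : x ∈ S.poles ↔ x = 1 ∨ x = -1 ∨ ∃ j, S.β j = x := by
  simp [poles]

theorem poles_subset_E : (S.poles : Set ℝ) ⊆ S.E := by
  intro x hx
  rw [S.mem_E_iff]
  rcases S.mem_poles.1 (Finset.mem_coe.1 hx) with rfl | rfl | ⟨j, rfl⟩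
  · exact ⟨by norm_num, fun j hj => (S.lt_one j).not_gt hj.2⟩
  · exact ⟨by norm_num, fun j hj => (S.neg_one_lt j).not_gt hj.1⟩
  · refine ⟨⟨(S.neg_one_lt_β j).le, (S.lt_one j).le⟩, fun i hi => ?_⟩
    rcases lt_trichotomy i j with h | rfl | h
    · exact hi.2.not_gt (S.β_lt_β h)
    · exact hi.2.false
    · exact hi.1.not_gt (S.right_lt_left j i h)

theorem prod_poles {M : Type*} [CommMonoid M] (f : ℝ → M) :
    ∏ e ∈ S.poles, f e = f 1 * (f (-1) * ∏ j, f (S.β j)) := by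
  rw [poles, Finset.prod_insert, Finset.prod_insert,
    Finset.prod_image S.β_strictMono.injective.injOn]
  · simpa using fun j => (S.neg_one_lt_β j).ne'
  · simpa using ⟨by norm_num, fun j => (S.lt_one j).ne⟩

theorem ae_notMem_ends : ∀ᵐ x : ℝ, x ∉ S.ends :=
  (Finset.countable_toSet S.ends).ae_notMem volume

theorem notMem_ends_iff {x : ℝ} : x ∉ S.ends ↔ x ∉ S.poles ∧ ∀ j, x ≠ S.α j := by
  simp [ends, eq_comm]

/-- The numerator `∏ (x - α_j)` of the rational function `ψ²`. -/
noncomputable def numer : ℝ[X] := ∏ j, (X - C (S.α j))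

/-- The denominator `(x² - 1) ∏ (x - β_j)` of the rational function `ψ²`. -/
noncomputable def denom : ℝ[X] := ∏ e ∈ S.poles, (X - C e)

theorem aeval_numer (z : ℂ) : aeval z S.numer = ∏ j, (z - S.α j) := by
  simp [numer, map_prod]

theorem aeval_denom (z : ℂ) : aeval z S.denom = ∏ e ∈ S.poles, (z - e) := by
  simp [denom, map_prod]

theorem monic_numer : S.numer.Monic := monic_prod_of_monic _ _ fun _ _ => monic_X_sub_C _

theorem monic_denom : S.denom.Monic := monic_prod_of_monic _ _ fun _ _ => monic_X_sub_C _

theorem w_eq_sqrt_numer_div_denom (x : ℝ) :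
    S.w x = 1 / Real.pi * √(-(S.numer.eval x / S.denom.eval x)) := by
  rw [w, numer, denom, eval_prod, eval_prod, S.prod_poles, ← div_neg]
  simp only [eval_sub, eval_X, eval_C]
  congr 4
  ring

theorem w_nonneg (x : ℝ) : 0 ≤ S.w x := by
  unfold w
  positivity

section Branch

open Filter Topology Asymptotics Bornology UpperHalfPlane

/-- The branch of `√(numer / denom)` that is holomorphic on the upper half plane and behaves like
`1 / z` at infinity. It turns out to be the Stieltjes transform of the weight. -/
noncomputable def branch (z : ℂ) : ℂ :=
  (∏ j, (z - S.α j).sqrt) * ∏ e ∈ S.poles, (z - e).sqrt⁻¹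

theorem branch_sq (z : ℂ) : S.branch z ^ 2 = aeval z S.numer / aeval z S.denom := by
  simp only [branch, mul_pow, ← Finset.prod_pow, inv_pow, complexSqrt_sq, aeval_numer, aeval_denom,
    Finset.prod_inv_distrib, div_eq_mul_inv]

theorem norm_branch (z : ℂ) :
    ‖S.branch z‖ = (∏ j, √‖z - S.α j‖) * ∏ e ∈ S.poles, (√‖z - e‖)⁻¹ := by
  simp only [branch, norm_mul, norm_prod, norm_inv, norm_complexSqrt]

theorem differentiableOn_branch : DifferentiableOn ℂ S.branch upperHalfPlaneSet := by
  intro z (hz : 0 < z.im)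
  have hsqrt (e : ℝ) : DifferentiableAt ℂ (fun z : ℂ => (z - e).sqrt) z :=
    DifferentiableAt.comp (f := fun z : ℂ => z - e) z
      (differentiableAt_complexSqrt (Or.inr (by simpa using hz.ne'))) (by fun_prop)
  have hne (e : ℝ) : (z - e).sqrt ≠ 0 :=
    complexSqrt_ne_zero fun h => hz.ne' (by simpa using congrArg Complex.im h)
  exact ((DifferentiableAt.fun_finsetProd fun j _ => hsqrt _).mul
    (DifferentiableAt.fun_finsetProd fun e _ => (hsqrt e).inv (hne e))).differentiableWithinAt

/-- A locally integrable majorant of `branch` near the real line. -/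
noncomputable def branchBound (x : ℝ) : ℝ :=
  √(|x| + 2) ^ g * ∏ e ∈ S.poles, (√|x - e|)⁻¹

theorem locallyIntegrable_branchBound : LocallyIntegrable S.branchBound := by
  simpa only [smul_eq_mul] using! (locallyIntegrable_prod_inv_sqrt_abs_sub S.poles).continuous_smul
    (show Continuous fun x : ℝ => √(|x| + 2) ^ g by fun_prop)

theorem norm_branch_le {x ε : ℝ} (hx : x ∉ S.ends) (h0 : 0 ≤ ε) (h1 : ε ≤ 1) :
    ‖S.branch (x + ε * Complex.I)‖ ≤ S.branchBound x := by
  rw [norm_branch, branchBound, ← Fin.prod_const]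
  gcongr with j _ e he
  · have hα : |S.α j| ≤ 1 := abs_le.2 ⟨(S.neg_one_lt j).le, (S.α_lt_one j).le⟩
    calc ‖(x : ℂ) + ε * Complex.I - S.α j‖
        ≤ ‖(x : ℂ)‖ + ‖(ε : ℂ) * Complex.I‖ + ‖(S.α j : ℂ)‖ :=
          (norm_sub_le _ _).trans (by gcongr; exact norm_add_le _ _)
      _ = |x| + ε + |S.α j| := by simp [abs_of_nonneg h0]
      _ ≤ |x| + 2 := by linarith
  · have hxe : x ≠ e := fun h => (S.notMem_ends_iff.1 hx).1 (h ▸ he)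
    exact Real.sqrt_pos.2 (abs_sub_pos.2 hxe)
  · simpa using Complex.abs_re_le_norm ((x : ℂ) + ε * Complex.I - e)

theorem tendsto_branch {x : ℝ} (hx : x ∉ S.ends) :
    Tendsto (fun ε : ℝ => S.branch (x + ε * Complex.I)) (𝓝[>] 0) (𝓝 (S.branch x)) := by
  have hsqrt (e : ℝ) : Tendsto (fun ε : ℝ => ((x : ℂ) + ε * Complex.I - e).sqrt) (𝓝[>] 0)
      (𝓝 ((x : ℂ) - e).sqrt) := by
    refine (continuousOn_complexSqrt ((x : ℂ) - e) (by simp)).tendsto.comp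
      (tendsto_nhdsWithin_iff.2 ⟨tendsto_add_mul_I_sub x e, ?_⟩)
    filter_upwards [self_mem_nhdsWithin] with ε hε
    simpa using le_of_lt hε
  refine (tendsto_finsetProd _ fun j _ => hsqrt _).mul
    (tendsto_finsetProd _ fun e he => (hsqrt e).inv₀ (complexSqrt_ne_zero ?_))
  have hxe : x ≠ e := fun h => (S.notMem_ends_iff.1 hx).1 (h ▸ he)
  exact_mod_cast sub_ne_zero.2 hxe

theorem hasBoundaryValues_branch : HasBoundaryValues S.branch fun x => S.branch x where
  differentiableOn := S.differentiableOn_branch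
  exists_bound := by
    refine ⟨S.branchBound, S.locallyIntegrable_branchBound, ?_⟩
    filter_upwards [Ioo_mem_nhdsGT one_pos] with ε hε
    exact S.ae_notMem_ends.mono fun x hx => S.norm_branch_le hx hε.1.le hε.2.le
  tendsto := S.ae_notMem_ends.mono fun x hx => S.tendsto_branch hx

theorem isBigO_branch : S.branch =O[cobounded ℂ] fun z => z⁻¹ := by
  refine IsBigO.of_pow two_ne_zero ?_
  have hnum : (fun z : ℂ => ∏ j, (z - S.α j)) =O[cobounded ℂ] fun z => ∏ _j : Fin g, z :=
    IsBigO.finsetProd fun j _ => (isBigO_refl _ _).sub (isLittleO_const_id_cobounded _).isBigO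
  have hden :
      (fun z : ℂ => ∏ e ∈ S.poles, (z - e)⁻¹) =O[cobounded ℂ] fun z => ∏ _e ∈ S.poles, z⁻¹ :=
    IsBigO.finsetProd fun e _ => isBigO_inv_sub _
  refine (hnum.mul hden).congr' (.of_forall fun z => ?_) ?_
  · simp only [Pi.pow_apply, branch_sq, aeval_numer, aeval_denom, Finset.prod_inv_distrib,
      div_eq_mul_inv]
  · filter_upwards [eventually_ne_cobounded (0 : ℂ)] with z hz
    rw [S.prod_poles]
    simp only [Finset.prod_const, Finset.card_univ, Fintype.card_fin, Pi.pow_apply]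
    field_simp
    rw [← mul_pow, mul_one_div_cancel hz, one_pow]

end Branch

section RealValues

open Topology Filter

theorem gap_factor_pos {x : ℝ} (hx : x ∉ S.ends) {j : Fin g} (hj : x ∉ Set.Ioo (S.α j) (S.β j)) :
    0 < (x - S.α j) / (x - S.β j) := by
  obtain ⟨hpole, hα⟩ := S.notMem_ends_iff.1 hx
  rcases lt_or_gt_of_ne (hα j) with h | h
  · exact div_pos_of_neg_of_neg (sub_neg.2 h) (sub_neg.2 (h.trans (S.left_lt_right j)))
  · refine div_pos (sub_pos.2 h) (sub_pos.2 ((not_lt.1 fun hβ => hj ⟨h, hβ⟩).lt_of_ne' ?_))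
    exact fun hβ => hpole (S.mem_poles.2 (.inr (.inr ⟨j, hβ.symm⟩)))

theorem abs_lt_one_of_mem_E {x : ℝ} (hx : x ∈ S.E) (hx' : x ∉ S.ends) : |x| < 1 := by
  have hpole := (S.notMem_ends_iff.1 hx').1
  rw [S.mem_poles, not_or, not_or] at hpole
  exact abs_lt.2 ⟨hx.1.1.lt_of_ne' hpole.2.1, hx.1.2.lt_of_ne hpole.1⟩

theorem numer_div_denom_eval (x : ℝ) : S.numer.eval x / S.denom.eval x =
    (∏ j, (x - S.α j) / (x - S.β j)) / (x ^ 2 - 1) := by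
  rw [numer, denom, eval_prod, eval_prod, S.prod_poles, Finset.prod_div_distrib, div_div]
  simp only [eval_sub, eval_X, eval_C]
  congr 1
  ring

theorem numer_div_denom_eval_neg {x : ℝ} (hx : x ∈ S.E) (hx' : x ∉ S.ends) :
    S.numer.eval x / S.denom.eval x < 0 := by
  rw [numer_div_denom_eval]
  have hgap : 0 < ∏ j, (x - S.α j) / (x - S.β j) :=
    Finset.prod_pos fun j _ => S.gap_factor_pos hx' ((S.mem_E_iff.1 hx).2 j)
  exact div_neg_of_pos_of_neg hgap
    (sub_neg.2 ((sq_lt_one_iff_abs_lt_one x).2 (S.abs_lt_one_of_mem_E hx hx')))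

theorem numer_div_denom_eval_nonneg {x : ℝ} (hx : x ∉ S.E) (hx' : x ∉ S.ends) :
    0 ≤ S.numer.eval x / S.denom.eval x := by
  rw [numer_div_denom_eval]
  by_cases hI : x ∈ Set.Icc (-1 : ℝ) 1
  · obtain ⟨i, hi⟩ : ∃ i, x ∈ Set.Ioo (S.α i) (S.β i) := by
      by_contra! hgap
      exact hx (S.mem_E_iff.2 ⟨hI, hgap⟩)
    refine div_nonneg_of_nonpos ?_
      (sub_nonpos.2 ((sq_le_one_iff_abs_le_one x).2 (abs_le.2 hI)))
    rw [← Finset.mul_prod_erase _ _ (Finset.mem_univ i)]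
    refine mul_nonpos_of_nonpos_of_nonneg
      (div_nonpos_of_nonneg_of_nonpos (sub_nonneg.2 hi.1.le) (sub_nonpos.2 hi.2.le))
      (Finset.prod_nonneg fun j hj => (S.gap_factor_pos hx' fun hj' => ?_).le)
    exact Finset.ne_of_mem_erase hj (S.eq_of_mem_gap hj' hi)
  · refine div_nonneg (Finset.prod_nonneg fun j _ => (S.gap_factor_pos hx' fun hj => ?_).le) ?_
    · exact hI ⟨((S.neg_one_lt j).trans hj.1).le, (hj.2.trans (S.lt_one j)).le⟩
    · rw [sub_nonneg, one_le_sq_iff_one_le_abs]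
      exact (not_le.1 fun h => hI (abs_le.1 h)).le

theorem w_pos {x : ℝ} (hx : x ∈ S.E) (hx' : x ∉ S.ends) : 0 < S.w x := by
  rw [w_eq_sqrt_numer_div_denom]
  exact mul_pos (by positivity)
    (Real.sqrt_pos.2 (neg_pos.2 (S.numer_div_denom_eval_neg hx hx')))

theorem branch_of_mem_E {x : ℝ} (hx : x ∈ S.E) (hx' : x ∉ S.ends) :
    S.branch x = -Complex.I * (Real.pi * S.w x : ℝ) := by
  have hlt := abs_lt.1 (S.abs_lt_one_of_mem_E hx hx')
  have hgap (j : Fin g) := S.gap_factor_pos hx' ((S.mem_E_iff.1 hx).2 j)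
  have hw : Real.pi * S.w x =
      (∏ j, √((x - S.α j) / (x - S.β j))) * ((√(1 - x))⁻¹ * (√(x + 1))⁻¹) := by
    rw [w_eq_sqrt_numer_div_denom, numer_div_denom_eval, ← Real.sqrt_prod _ fun j _ => (hgap j).le,
      ← mul_assoc, mul_one_div_cancel Real.pi_ne_zero, one_mul, ← div_neg, neg_sub,
      Real.sqrt_div (Finset.prod_nonneg fun j _ => (hgap j).le),
      show 1 - x ^ 2 = (1 - x) * (x + 1) by ring, Real.sqrt_mul (by linarith), div_eq_mul_inv,
      mul_inv]
  have hprod : (∏ j, (x - S.α j : ℂ).sqrt) * ∏ j, (x - S.β j : ℂ).sqrt⁻¹ =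
      (∏ j, √((x - S.α j) / (x - S.β j)) : ℝ) := by
    rw [← Finset.prod_mul_distrib, Complex.ofReal_prod]
    refine Finset.prod_congr rfl fun j _ => ?_
    rw [← complexSqrt_div_complexSqrt (hgap j), Complex.ofReal_sub, Complex.ofReal_sub,
      div_eq_mul_inv]
  have hleft : (x - (1 : ℝ) : ℂ).sqrt = Complex.I * √(1 - x) := by
    rw [← Complex.ofReal_sub, complexSqrt_ofReal_of_nonpos (by linarith), neg_sub]
  have hright : (x - (-1 : ℝ) : ℂ).sqrt = √(x + 1) := by
    rw [← Complex.ofReal_sub, sub_neg_eq_add, complexSqrt_ofReal (by linarith)]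
  rw [hw, branch, S.prod_poles, hleft, hright, mul_inv, Complex.inv_I, Complex.ofReal_mul, ← hprod]
  push_cast
  ring

theorem branch_im_of_notMem_E {x : ℝ} (hx : x ∉ S.E) (hx' : x ∉ S.ends) : (S.branch x).im = 0 := by
  have hsq : S.branch x ^ 2 = (√(S.numer.eval x / S.denom.eval x) : ℂ) ^ 2 := by
    rw [branch_sq, ← Complex.ofReal_pow, Real.sq_sqrt (S.numer_div_denom_eval_nonneg hx hx'),
      Complex.ofReal_div, aeval_complex_ofReal,
      aeval_complex_ofReal]
  rcases sq_eq_sq_iff_eq_or_eq_neg.1 hsq with h | h <;> simp [h]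

theorem ae_branch_im :
    ∀ᵐ x : ℝ, (S.branch x).im = S.E.indicator (fun t => -(Real.pi * S.w t)) x := by
  filter_upwards [S.ae_notMem_ends] with x hx
  by_cases hE : x ∈ S.E
  · rw [Set.indicator_of_mem hE, S.branch_of_mem_E hE hx]
    simp
  · rw [Set.indicator_of_notMem hE, S.branch_im_of_notMem_E hE hx]

theorem integrableOn_w : IntegrableOn S.w S.E := by
  refine ((S.locallyIntegrable_branchBound.integrableOn_isCompact S.isCompact_E).const_mul
    Real.pi⁻¹).mono' (Measurable.aestronglyMeasurable (by unfold w; fun_prop)) ?_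
  filter_upwards [ae_restrict_mem S.measurableSet_E, ae_restrict_of_ae S.ae_notMem_ends]
    with x hx hx'
  have hle := S.norm_branch_le hx' le_rfl zero_le_one
  simp only [Complex.ofReal_zero, zero_mul, add_zero, S.branch_of_mem_E hx hx'] at hle
  rw [le_inv_mul_iff₀ Real.pi_pos]
  simpa [abs_of_nonneg Real.pi_pos.le] using hle

theorem volume_E_ne_zero : volume S.E ≠ 0 := by
  have hE : ∀ᶠ x in 𝓝[>] (-1 : ℝ), x ∈ S.E := by
    filter_upwards [Ioo_mem_nhdsGT (show (-1 : ℝ) < 1 by norm_num),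
      eventually_all.2 fun j => Ioo_mem_nhdsGT (S.neg_one_lt j)] with x hx hα
    exact S.mem_E_iff.2 ⟨Set.Ioo_subset_Icc_self hx, fun j hj => (hα j).2.not_gt hj.1⟩
  obtain ⟨u, hu, hsub⟩ := mem_nhdsGT_iff_exists_Ioo_subset.1 hE
  exact (measure_pos_of_superset hsub (by
    simpa [neg_lt_iff_pos_add] using hu)).ne'

end RealValues

section StieltjesTransform

open Filter Topology

/-- The Stieltjes transform of the weight, which is `ψ` off `E`. -/
noncomputable def stieltjes (z : ℂ) : ℂ := ∫ t in S.E, (S.w t : ℂ) / (z - t)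

theorem stieltjes_eq_branch {z : ℂ} (hz : 0 < z.im) : S.stieltjes z = S.branch z := by
  have hint := S.hasBoundaryValues_branch.integral_im_div_sub (S.isBigO_branch.mono inf_le_left) hz
  have hae : ∀ᵐ x : ℝ, ((S.branch x).im : ℂ) / (x - z) =
      S.E.indicator (fun t : ℝ => Real.pi * ((S.w t : ℂ) / (z - t))) x := by
    filter_upwards [S.ae_branch_im] with x hx
    rw [hx]
    by_cases hE : x ∈ S.E
    · rw [Set.indicator_of_mem hE, Set.indicator_of_mem hE, ← neg_sub z, Complex.ofReal_neg,
        neg_div_neg_eq, Complex.ofReal_mul, mul_div_assoc]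
    · rw [Set.indicator_of_notMem hE, Set.indicator_of_notMem hE, Complex.ofReal_zero, zero_div]
  rw [integral_congr_ae hae, integral_indicator S.measurableSet_E, integral_const_mul] at hint
  exact mul_left_cancel₀ (Complex.ofReal_ne_zero.2 Real.pi_ne_zero) hint

theorem stieltjes_conj (z : ℂ) :
    S.stieltjes ((starRingEnd ℂ) z) = (starRingEnd ℂ) (S.stieltjes z) := by
  rw [stieltjes, stieltjes, ← integral_conj]
  simp

theorem tendsto_stieltjes {x : ℝ} (hx : x ∉ S.E) :
    Tendsto (fun ε : ℝ => S.stieltjes (x + ε * Complex.I)) (𝓝[>] 0) (𝓝 (S.stieltjes x)) := by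
  obtain ⟨δ, hδ, hball⟩ := Metric.isOpen_iff.1 S.isCompact_E.isClosed.isOpen_compl x hx
  have hdist : ∀ t ∈ S.E, δ ≤ |x - t| := fun t ht => by
    by_contra! hlt
    exact hball (by rwa [Metric.mem_ball', Real.dist_eq]) ht
  refine tendsto_integral_filter_of_dominated_convergence (fun t => S.w t / δ)
    (.of_forall fun ε => Measurable.aestronglyMeasurable (by unfold w; fun_prop))
    (.of_forall fun ε => ?_) (S.integrableOn_w.div_const _) ?_
  · filter_upwards [ae_restrict_mem S.measurableSet_E] with t ht
    rw [norm_div, Complex.norm_real, Real.norm_of_nonneg (S.w_nonneg t)]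
    gcongr
    · exact S.w_nonneg t
    · exact (hdist t ht).trans
        (by simpa using Complex.abs_re_le_norm ((x : ℂ) + ε * Complex.I - t))
  · filter_upwards [ae_restrict_mem S.measurableSet_E] with t ht
    have hne : x - t ≠ 0 := abs_pos.1 (hδ.trans_le (hdist t ht))
    exact tendsto_const_nhds.div (tendsto_add_mul_I_sub x t) (by exact_mod_cast hne)

theorem aeval_denom_ne_zero {z : ℂ} (hz : ¬ (z.im = 0 ∧ z.re ∈ S.E)) : aeval z S.denom ≠ 0 := by
  rw [aeval_denom, Finset.prod_ne_zero_iff]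
  rintro e he h
  rw [sub_eq_zero.1 h] at hz
  exact hz ⟨Complex.ofReal_im e, S.poles_subset_E he⟩

theorem stieltjes_sq_of_im_pos {z : ℂ} (hz : 0 < z.im) :
    S.stieltjes z ^ 2 = aeval z S.numer / aeval z S.denom := by
  rw [S.stieltjes_eq_branch hz, branch_sq]

theorem stieltjes_sq_of_notMem_E {x : ℝ} (hx : x ∉ S.E) :
    S.stieltjes x ^ 2 = aeval (x : ℂ) S.numer / aeval (x : ℂ) S.denom := by
  have hlim (p : ℝ[X]) : Tendsto (fun ε : ℝ => aeval ((x : ℂ) + ε * Complex.I) p) (𝓝[>] 0)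
      (𝓝 (aeval (x : ℂ) p)) :=
    (p.continuous_aeval.tendsto _).comp (by simpa using tendsto_add_mul_I_sub x 0)
  refine tendsto_nhds_unique ((S.tendsto_stieltjes hx).pow 2)
    (((hlim S.numer).div (hlim S.denom) (S.aeval_denom_ne_zero (by simpa))).congr' ?_)
  filter_upwards [self_mem_nhdsWithin] with ε hε
  exact (S.stieltjes_sq_of_im_pos (by simpa using hε)).symm

theorem stieltjes_sq {z : ℂ} (hz : ¬ (z.im = 0 ∧ z.re ∈ S.E)) :
    S.stieltjes z ^ 2 = aeval z S.numer / aeval z S.denom := by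
  rcases lt_trichotomy z.im 0 with h | h | h
  · have hconj := S.stieltjes_sq_of_im_pos (z := (starRingEnd ℂ) z) (by simpa using h)
    rw [stieltjes_conj, aeval_conj, aeval_conj, ← map_pow, ← map_div₀] at hconj
    exact (starRingEnd ℂ).injective hconj
  · lift z to ℝ using h
    exact S.stieltjes_sq_of_notMem_E fun hx => hz ⟨rfl, hx⟩
  · exact S.stieltjes_sq_of_im_pos h

theorem numer_div_denom_eval_nonpos {x : ℝ} (hx : x ∈ S.E) (hα : ∀ j, x ≠ S.α j) :
    S.numer.eval x / S.denom.eval x ≤ 0 := by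
  by_cases hpole : x ∈ S.poles
  · rw [denom, eval_prod, Finset.prod_eq_zero hpole (by simp), div_zero]
  · exact (S.numer_div_denom_eval_neg hx (S.notMem_ends_iff.2 ⟨hpole, hα⟩)).le

theorem psi_sq {z : ℂ} (hz : ∀ i, z ≠ S.α i) :
    S.psi z ^ 2 = aeval z S.numer / aeval z S.denom := by
  rw [psi]
  split_ifs with h
  · obtain ⟨him, hE⟩ := h
    lift z to ℝ using him
    have hw : (Real.pi * S.w z) ^ 2 = -(S.numer.eval z / S.denom.eval z) := by
      rw [w_eq_sqrt_numer_div_denom, ← mul_assoc, mul_one_div_cancel Real.pi_ne_zero, one_mul,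
        Real.sq_sqrt]
      exact neg_nonneg.2 (S.numer_div_denom_eval_nonpos hE (by exact_mod_cast hz))
    rw [aeval_complex_ofReal, aeval_complex_ofReal, Complex.ofReal_re, div_mul_eq_mul_div, div_pow,
      Complex.I_sq, div_neg, div_one, neg_eq_iff_eq_neg]
    exact_mod_cast hw
  · exact S.stieltjes_sq h

end StieltjesTransform

section Moments

theorem integrableOn_mul_w {f : ℝ → ℝ} (hf : ContinuousOn f S.E) :
    IntegrableOn (fun t => f t * S.w t) S.E :=
  S.integrableOn_w.continuousOn_mul hf S.isCompact_E

theorem integrableOn_eval_mul_w (p : ℝ[X]) : IntegrableOn (fun t => p.eval t * S.w t) S.E :=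
  S.integrableOn_mul_w p.continuous.continuousOn

/-- The moment functional `p ↦ ∫_E p w dx` of the weight. -/
noncomputable def moment : ℝ[X] →ₗ[ℝ] ℝ where
  toFun p := ∫ t in S.E, p.eval t * S.w t
  map_add' p q := by
    simp only [eval_add, add_mul]
    exact integral_add (S.integrableOn_eval_mul_w p) (S.integrableOn_eval_mul_w q)
  map_smul' c p := by
    simp only [eval_smul, smul_eq_mul, mul_assoc, RingHom.id_apply]
    exact integral_const_mul _ _

theorem moment_apply (p : ℝ[X]) : S.moment p = ∫ t in S.E, p.eval t * S.w t := rfl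

theorem ip_eq_moment (p q : ℝ[X]) : S.ip p q = S.moment (p * q) := by
  simp only [ip, moment_apply, eval_mul]

theorem moment_mul_self_pos {p : ℝ[X]} (hp : p ≠ 0) : 0 < S.moment (p * p) := by
  refine (setIntegral_pos_iff_support_of_nonneg_ae (ae_of_all _ fun x => ?_)
    (S.integrableOn_eval_mul_w _)).2 ?_
  · rw [eval_mul]
    exact mul_nonneg (mul_self_nonneg _) (S.w_nonneg x)
  · have hroots : ∀ᵐ x : ℝ, x ∉ p.roots.toFinset :=
      (Finset.countable_toSet _).ae_notMem volume
    refine pos_iff_ne_zero.2 fun h0 => S.volume_E_ne_zero (measure_mono_null_ae ?_ h0)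
    filter_upwards [hroots, S.ae_notMem_ends] with x hx hends hE
    refine ⟨?_, hE⟩
    have hpx : p.eval x ≠ 0 := fun h => hx (by simpa [hp] using h)
    simpa using ⟨hpx, (S.w_pos hE hends).ne'⟩

end Moments

section OrthogonalPolynomialsOnE

theorem P_eq_X_pow_sub_sum (n : ℕ) :
    S.P n = X ^ n - ∑ k ∈ Finset.range n, (S.moment (X ^ n * S.P k) / S.h k) • S.P k := by
  rw [P, ← Fin.sum_univ_eq_sum_range fun k => (S.moment (X ^ n * S.P k) / S.h k) • S.P k]
  simp only [smul_eq_C_mul, h, ip_eq_moment]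

theorem monic_P_and_natDegree_P (n : ℕ) : (S.P n).Monic ∧ (S.P n).natDegree = n := by
  induction n using Nat.strong_induction_on with
  | _ n ih =>
    have hsum : (∑ k ∈ Finset.range n, (S.moment (X ^ n * S.P k) / S.h k) • S.P k).degree < n := by
      rw [← mem_degreeLT]
      refine sum_mem fun k hk => Submodule.smul_mem _ _ (mem_degreeLT.2 ?_)
      have hk := Finset.mem_range.1 hk
      exact degree_le_natDegree.trans_lt (by rw [(ih k hk).2]; exact_mod_cast hk)
    rw [P_eq_X_pow_sub_sum]
    refine ⟨monic_X_pow_sub hsum, natDegree_eq_of_degree_eq_some ?_⟩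
    rw [degree_sub_eq_left_of_degree_lt (by rwa [degree_X_pow]), degree_X_pow]

theorem h_eq_moment (n : ℕ) : S.h n = S.moment (S.P n * S.P n) := S.ip_eq_moment _ _

theorem h_pos (n : ℕ) : 0 < S.h n := by
  rw [h_eq_moment]
  exact S.moment_mul_self_pos (S.monic_P_and_natDegree_P n).1.ne_zero

theorem moment_P_mul_P {m n : ℕ} (hmn : m < n) : S.moment (S.P n * S.P m) = 0 := by
  induction n using Nat.strong_induction_on generalizing m with
  | _ n ih =>
    rw [P_eq_X_pow_sub_sum, sub_mul, Finset.sum_mul, map_sub, map_sum,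
      Finset.sum_eq_single_of_mem m (Finset.mem_range.2 hmn), smul_mul_assoc, map_smul, smul_eq_mul,
      ← h_eq_moment, div_mul_cancel₀ _ (S.h_pos m).ne', sub_self]
    intro k hk hkm
    rw [smul_mul_assoc, map_smul]
    rcases lt_or_gt_of_ne hkm with hlt | hlt
    · rw [mul_comm (S.P k), ih m hmn hlt, smul_zero]
    · rw [ih k (Finset.mem_range.1 hk) hlt, smul_zero]

theorem isMonicOrthogonal_P : IsMonicOrthogonal S.moment S.P where
  monic n := (S.monic_P_and_natDegree_P n).1
  natDegree_eq n := (S.monic_P_and_natDegree_P n).2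
  map_mul_eq_zero := S.moment_P_mul_P

theorem P_zero : S.P 0 = 1 := S.isMonicOrthogonal_P.zero_eq_one

theorem a_succ_mul_h (n : ℕ) : S.a (n + 1) * S.h n = S.h (n + 1) := by
  rw [a, Nat.add_sub_cancel, div_mul_cancel₀ _ (S.h_pos n).ne', ip_eq_moment, mul_comm,
    S.isMonicOrthogonal_P.map_mul_X_mul, h_eq_moment]

theorem b_succ_mul_h (n : ℕ) : S.b (n + 1) * S.h n = S.moment (S.P n * (X * S.P n)) := by
  rw [b, Nat.add_sub_cancel, div_mul_cancel₀ _ (S.h_pos n).ne', ip_eq_moment, mul_comm]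

theorem isJacobiSolution_P : IsJacobiSolution S.a S.b X S.P := by
  refine S.isMonicOrthogonal_P.recurrence (fun n => ?_) (fun n => ?_) fun n => ?_ <;>
    rw [← h_eq_moment]
  exacts [(S.h_pos n).ne', (S.a_succ_mul_h n).trans (S.h_eq_moment _), S.b_succ_mul_h n]

theorem P_one : S.P 1 = X - C (S.b 1) := by
  have hone : S.moment 1 = S.h 0 := by rw [h_eq_moment, P_zero, mul_one]
  refine S.isMonicOrthogonal_P.one_eq (hone ▸ (S.h_pos 0).ne') ?_
  rw [hone, S.b_succ_mul_h 0, P_zero, one_mul, mul_one]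

end OrthogonalPolynomialsOnE

section FunctionsOfSecondKind

open Filter Topology

/-- The function of the second kind `∫_E p(t) w(t) / (x - t) dt` of a polynomial `p`. -/
noncomputable def transform (p : ℝ[X]) (x : ℝ) : ℝ := ∫ t in S.E, p.eval t * S.w t / (x - t)

theorem integrableOn_transform (p : ℝ[X]) {x : ℝ} (hx : 1 < x) :
    IntegrableOn (fun t => p.eval t * S.w t / (x - t)) S.E := by
  simp only [div_eq_inv_mul]
  refine (S.integrableOn_eval_mul_w p).continuousOn_mul ?_ S.isCompact_E
  exact ContinuousOn.inv₀ (by fun_prop) fun t ht => (sub_pos.2 (ht.1.2.trans_lt hx)).ne'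

theorem isLinearMap_transform {x : ℝ} (hx : 1 < x) : IsLinearMap ℝ fun p => S.transform p x where
  map_add p r := by
    simp only [transform, eval_add, add_mul, add_div]
    exact integral_add (S.integrableOn_transform p hx) (S.integrableOn_transform r hx)
  map_smul c p := by
    simp only [transform, eval_smul, smul_eq_mul, mul_assoc, mul_div_assoc]
    exact integral_const_mul _ _

theorem transform_X_mul (p : ℝ[X]) {x : ℝ} (hx : 1 < x) :
    S.transform (X * p) x = x * S.transform p x - S.moment p := by
  rw [transform, transform, moment_apply, ← integral_const_mul,
    ← integral_sub ((S.integrableOn_transform p hx).const_mul x) (S.integrableOn_eval_mul_w p)]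
  refine setIntegral_congr_fun S.measurableSet_E fun t ht => ?_
  have hxt : x - t ≠ 0 := (sub_pos.2 (ht.1.2.trans_lt hx)).ne'
  simp only [eval_mul, eval_X]
  field_simp
  ring

theorem tendsto_transform (p : ℝ[X]) : Tendsto (S.transform p) atTop (𝓝 0) := by
  rw [← integral_zero ℝ ℝ (μ := volume.restrict S.E)]
  refine tendsto_integral_filter_of_dominated_convergence (fun t => |p.eval t * S.w t|) ?_ ?_
    (S.integrableOn_eval_mul_w p).abs (ae_of_all _ fun t => ?_)
  · filter_upwards [eventually_gt_atTop 1] with x hx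
    exact (S.integrableOn_transform p hx).aestronglyMeasurable
  · filter_upwards [eventually_ge_atTop 2] with x hx
    filter_upwards [ae_restrict_mem S.measurableSet_E] with t ht
    have hxt : 1 ≤ x - t := by linarith [ht.1.2]
    rw [norm_div, Real.norm_of_nonneg (zero_le_one.trans hxt), Real.norm_eq_abs]
    exact div_le_self (abs_nonneg _) hxt
  · exact tendsto_const_nhds.div_atTop (tendsto_atTop_add_const_right _ _ tendsto_id)

theorem tendsto_mul_transform (p : ℝ[X]) :
    Tendsto (fun x => x * S.transform p x) atTop (𝓝 (S.moment p)) := by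
  have h := (S.tendsto_transform (X * p)).add_const (S.moment p)
  rw [zero_add] at h
  refine h.congr' ?_
  filter_upwards [eventually_gt_atTop 1] with x hx
  rw [S.transform_X_mul p hx, sub_add_cancel]

theorem transform_X_pow_mul_P {k n : ℕ} (hk : k ≤ n) {x : ℝ} (hx : 1 < x) :
    S.transform (X ^ k * S.P n) x = x ^ k * S.transform (S.P n) x := by
  induction k with
  | zero => simp
  | succ k ih =>
    have horth : S.moment (X ^ k * S.P n) = 0 := by
      rw [mul_comm]
      exact S.isMonicOrthogonal_P.map_mul_eq_zero_of_degree_lt (by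
        rw [degree_X_pow]
        exact_mod_cast hk)
    rw [pow_succ', mul_assoc, S.transform_X_mul _ hx, horth, ih (Nat.le_of_succ_le hk), sub_zero,
      pow_succ', mul_assoc]

theorem tendsto_pow_mul_transform_P (n : ℕ) :
    Tendsto (fun x => x ^ (n + 1) * S.transform (S.P n) x) atTop (𝓝 (S.h n)) := by
  have hmoment : S.moment (X ^ n * S.P n) = S.h n := by
    rw [mul_comm, S.isMonicOrthogonal_P.map_mul_eq_coeff_mul (natDegree_X_pow_le n),
      coeff_X_pow_self, one_mul, h_eq_moment]
  refine (hmoment ▸ S.tendsto_mul_transform (X ^ n * S.P n)).congr' ?_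
  filter_upwards [eventually_gt_atTop 1] with x hx
  rw [S.transform_X_pow_mul_P le_rfl hx, pow_succ', mul_assoc]

theorem stieltjes_ofReal (x : ℝ) : S.stieltjes x = (S.transform 1 x : ℂ) := by
  rw [stieltjes, transform, ← integral_complex_ofReal]
  simp

theorem eval_denom_ne_zero {x : ℝ} (hx : 1 < x) : S.denom.eval x ≠ 0 := fun h =>
  S.aeval_denom_ne_zero (z := x) (fun hE => hx.not_ge hE.2.1.2) (by
    rw [aeval_complex_ofReal, h, Complex.ofReal_zero])

theorem transform_one_sq {x : ℝ} (hx : 1 < x) :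
    S.transform 1 x ^ 2 = S.numer.eval x / S.denom.eval x := by
  have h := S.stieltjes_sq_of_notMem_E fun hE => hx.not_ge hE.1.2
  rw [stieltjes_ofReal, aeval_complex_ofReal, aeval_complex_ofReal] at h
  exact_mod_cast h

theorem natDegree_numer : S.numer.natDegree = g := by
  rw [numer, natDegree_prod_of_monic _ _ fun _ _ => monic_X_sub_C _]
  simp

theorem natDegree_denom : S.denom.natDegree = g + 2 := by
  have hβ : (∏ j, (X - C (S.β j))).Monic := monic_prod_of_monic _ _ fun _ _ => monic_X_sub_C _
  rw [denom, S.prod_poles, (monic_X_sub_C 1).natDegree_mul ((monic_X_sub_C (-1)).mul hβ),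
    (monic_X_sub_C (-1)).natDegree_mul hβ, natDegree_prod_of_monic _ _ fun _ _ => monic_X_sub_C _]
  simp only [natDegree_X_sub_C, Finset.sum_const, Finset.card_univ, Fintype.card_fin, smul_eq_mul]
  ring

theorem h_zero : S.h 0 = 1 := by
  have hh : S.h 0 = S.moment 1 := by rw [h_eq_moment, P_zero, mul_one]
  have hdeg : (X ^ 2 * S.numer).natDegree = S.denom.natDegree := by
    rw [(monic_X_pow 2).natDegree_mul S.monic_numer, natDegree_X_pow, natDegree_numer,
      natDegree_denom, add_comm]
  have hmonic : (X ^ 2 * S.numer).Monic := (monic_X_pow 2).mul S.monic_numer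
  have hone : Tendsto (fun x => (X ^ 2 * S.numer).eval x / S.denom.eval x) atTop (𝓝 1) := by
    have h := div_tendsto_atTop_leadingCoeff_div_of_degree_eq (X ^ 2 * S.numer) S.denom (by
      rw [degree_eq_natDegree hmonic.ne_zero, degree_eq_natDegree S.monic_denom.ne_zero, hdeg])
    rwa [hmonic.leadingCoeff, S.monic_denom.leadingCoeff, div_one] at h
  have hsq : S.h 0 ^ 2 = 1 := by
    refine tendsto_nhds_unique ((hh ▸ S.tendsto_mul_transform 1).pow 2) (hone.congr' ?_)
    filter_upwards [eventually_gt_atTop 1] with x hx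
    rw [mul_pow, S.transform_one_sq hx, eval_mul, eval_pow, eval_X, mul_div_assoc]
  exact (pow_eq_one_iff_of_nonneg (S.h_pos 0).le two_ne_zero).1 hsq

end FunctionsOfSecondKind

section PolynomialsOfSecondKind

theorem moment_one : S.moment 1 = 1 := by
  rw [← S.h_zero, h_eq_moment, P_zero, mul_one]

/-- The polynomials of the second kind `Q_n`, defined by their recurrence; `Q_1` is the total mass
of the weight. -/
noncomputable def Q : ℕ → ℝ[X]
  | 0 => 0
  | 1 => 1
  | n + 2 => X * Q (n + 1) - S.b (n + 2) • Q (n + 1) - S.a (n + 1) • Q n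

theorem Q_zero : S.Q 0 = 0 := by rw [Q]

theorem Q_one : S.Q 1 = 1 := by rw [Q]

theorem isJacobiSolution_Q : IsJacobiSolution S.a S.b X S.Q := fun n => by rw [Q]

theorem map_P_eq_aeval_Q {A : Type*} [CommRing A] [Algebra ℝ A] {T : ℝ[X] → A}
    (hT : IsLinearMap ℝ T) {x e : A} (hX : ∀ p, T (X * p) = x * T p + S.moment p • e) (n : ℕ) :
    T (S.P n) = aeval x (S.P n) * T 1 + aeval x (S.Q n) * e := by
  have hP := (S.isJacobiSolution_P.map (aeval x)).mul_const (T 1)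
  have hQ := (S.isJacobiSolution_Q.map (aeval x)).mul_const e
  have hT' := S.isMonicOrthogonal_P.isJacobiSolution_of_map_X_mul S.isJacobiSolution_P hT hX
  rw [aeval_X] at hP hQ
  refine hT'.ext (hP.add hQ) ?_ ?_ n
  · simp [P_zero, Q_zero]
  · have hC : (X - C (S.b 1) : ℝ[X]) = X * 1 - S.b 1 • 1 := by rw [mul_one, smul_eq_C_mul, mul_one]
    have hx : aeval x (X - C (S.b 1)) = x - algebraMap ℝ A (S.b 1) := by simp
    rw [P_one, Q_one, hx, hC, hT.map_sub, hT.map_smul, hX, moment_one, one_smul,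
      map_one, Algebra.smul_def]
    ring

theorem transform_P (n : ℕ) {x : ℝ} (hx : 1 < x) :
    S.transform (S.P n) x = (S.P n).eval x * S.transform 1 x - (S.Q n).eval x := by
  have h := S.map_P_eq_aeval_Q (S.isLinearMap_transform hx) (x := x) (e := -1)
    (fun p => by rw [S.transform_X_mul p hx, smul_eq_mul]; ring) n
  rw [h, coe_aeval_eq_eval]
  ring

/-- The integral `∫_E (p(z) - p(t)) / (z - t) w(t) dt` that defines `Q_n` for `p = P_n`. -/
noncomputable def secondKind (p : ℝ[X]) (z : ℂ) : ℂ :=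
  ∫ t in S.E, (aeval z p - aeval (t : ℂ) p) / (z - t) * S.w t

theorem ae_ofReal_ne (z : ℂ) : ∀ᵐ t : ℝ ∂volume.restrict S.E, z - t ≠ 0 := by
  refine ae_restrict_of_ae ?_
  filter_upwards [Measure.ae_ne volume z.re] with t ht h
  exact ht (by rw [sub_eq_zero.1 h, Complex.ofReal_re])

theorem integrableOn_secondKind (p : ℝ[X]) (z : ℂ) :
    IntegrableOn (fun t : ℝ => (aeval z p - aeval (t : ℂ) p) / (z - t) * (S.w t : ℂ)) S.E := by
  have hcont : Continuous (dslope (fun u : ℂ => aeval u p) z) := by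
    rw [← continuousOn_univ, continuousOn_dslope Filter.univ_mem]
    exact ⟨p.continuous_aeval.continuousOn, p.differentiableAt_aeval⟩
  refine (IntegrableOn.continuousOn_mul (hcont.comp Complex.continuous_ofReal).continuousOn
    S.integrableOn_w.ofReal S.isCompact_E).congr ?_
  filter_upwards [S.ae_ofReal_ne z] with t ht
  rw [Function.comp_apply, dslope_of_ne _ (sub_ne_zero.1 ht).symm, slope_def_field,
    ← neg_div_neg_eq, neg_sub, neg_sub]
  rfl

theorem isLinearMap_secondKind (z : ℂ) : IsLinearMap ℝ fun p => S.secondKind p z where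
  map_add p r := by
    rw [secondKind, secondKind, secondKind,
      ← integral_add (S.integrableOn_secondKind p z) (S.integrableOn_secondKind r z)]
    congr 1 with t
    rw [map_add, map_add]
    ring
  map_smul c p := by
    rw [secondKind, secondKind, ← integral_smul]
    congr 1 with t
    rw [map_smul, map_smul, ← smul_sub, smul_div_assoc, smul_mul_assoc]

theorem secondKind_X_mul (p : ℝ[X]) (z : ℂ) :
    S.secondKind (X * p) z = z * S.secondKind p z + S.moment p • 1 := by
  have hint : IntegrableOn (fun t => ((p.eval t * S.w t : ℝ) : ℂ)) S.E :=
    (S.integrableOn_eval_mul_w p).ofReal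
  rw [secondKind, secondKind, moment_apply, Complex.real_smul, mul_one, ← integral_complex_ofReal,
    ← integral_const_mul, ← integral_add ((S.integrableOn_secondKind p z).const_mul z) hint]
  refine integral_congr_ae ?_
  filter_upwards [S.ae_ofReal_ne z] with t ht
  simp only [map_mul, aeval_X, Complex.ofReal_mul, ← aeval_complex_ofReal]
  field_simp
  ring

theorem evalQ_eq_aeval (n : ℕ) (z : ℂ) : S.evalQ n z = aeval z (S.Q n) := by
  have hone : S.secondKind 1 z = 0 := by simp [secondKind]
  have h := S.map_P_eq_aeval_Q (S.isLinearMap_secondKind z) (S.secondKind_X_mul · z) n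
  rwa [hone, mul_zero, zero_add, mul_one] at h

end PolynomialsOfSecondKind

section Periodicity

open Filter Topology Asymptotics

variable {S} in
theorem HasPeriod.mul {K : ℕ} (hK : S.HasPeriod K) (m : ℕ) : S.HasPeriod (m * K) := by
  induction m with
  | zero => exact ⟨fun n _ => by simp, fun n _ => by simp⟩
  | succ m ih =>
    refine ⟨fun n hn => ?_, fun n hn => ?_⟩
    · rw [add_mul, one_mul, ← add_assoc, hK.1 _ (by omega), ih.1 n hn]
    · rw [add_mul, one_mul, ← add_assoc, hK.2 _ (by omega), ih.2 n hn]

theorem numer_not_isRoot_one : ¬ S.numer.IsRoot 1 := by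
  rw [IsRoot.def, numer, eval_prod, Finset.prod_eq_zero_iff]
  rintro ⟨i, -, h⟩
  rw [eval_sub, eval_X, eval_C] at h
  linarith [S.α_lt_one i]

theorem rootMultiplicity_denom : S.denom.rootMultiplicity 1 = 1 := by
  have hroot : ¬ ((X - C (-1)) * ∏ j, (X - C (S.β j))).IsRoot 1 := by
    rw [IsRoot.def, eval_mul, eval_prod, mul_eq_zero, Finset.prod_eq_zero_iff]
    rintro (h | ⟨j, -, h⟩)
    · norm_num at h
    · rw [eval_sub, eval_X, eval_C] at h
      linarith [S.lt_one j]
  have hdenom := S.monic_denom.ne_zero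
  rw [denom, S.prod_poles] at hdenom ⊢
  rw [rootMultiplicity_mul hdenom, rootMultiplicity_X_sub_C_self, rootMultiplicity_eq_zero hroot]

theorem eq_zero_of_sq_mul_denom_eq {u v : ℝ[X]} (h : u ^ 2 * S.denom = v ^ 2 * S.numer) :
    u = 0 ∧ v = 0 := by
  have hv : v = 0 := by
    by_contra hv
    have hvn : v ^ 2 * S.numer ≠ 0 := mul_ne_zero (pow_ne_zero 2 hv) S.monic_numer.ne_zero
    have hu : u ≠ 0 := by
      rintro rfl
      exact hvn (by rw [← h]; simp)
    have hparity := congrArg (rootMultiplicity 1) h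
    rw [rootMultiplicity_mul (h ▸ hvn), rootMultiplicity_mul hvn, rootMultiplicity_denom,
      rootMultiplicity_eq_zero S.numer_not_isRoot_one, sq, sq,
      rootMultiplicity_mul (mul_ne_zero hu hu), rootMultiplicity_mul (mul_ne_zero hv hv)] at hparity
    omega
  subst hv
  simpa [S.monic_denom.ne_zero] using h

theorem eq_zero_of_superpolynomialDecay_sub {u v : ℝ[X]}
    (h : SuperpolynomialDecay atTop id fun x => u.eval x - v.eval x * S.transform 1 x) :
    u = 0 ∧ v = 0 := by
  suffices hlim : Tendsto (fun x => (u ^ 2 * S.denom - v ^ 2 * S.numer).eval x) atTop (𝓝 0) from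
    S.eq_zero_of_sq_mul_denom_eq
      (sub_eq_zero.1 (leadingCoeff_eq_zero.1 ((tendsto_nhds_iff _).1 hlim).1))
  have hu := ((h.mul_polynomial u).mul_polynomial S.denom) 0
  have hv := ((h.mul_polynomial v).mul_polynomial S.denom) 0
  have hconj := hu.add (hv.mul (S.tendsto_transform 1))
  simp only [mul_zero, add_zero, pow_zero, one_mul, id] at hconj
  refine hconj.congr' ?_
  filter_upwards [eventually_gt_atTop 1] with x hx
  have hsq := S.transform_one_sq hx
  rw [eq_div_iff (S.eval_denom_ne_zero hx)] at hsq
  simp only [eval_sub, eval_mul, eval_pow]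
  linear_combination -(v.eval x) ^ 2 * hsq

theorem isJacobiSolution_transform_P {x : ℝ} (hx : 1 < x) :
    IsJacobiSolution S.a S.b x fun n => S.transform (S.P n) x :=
  S.isMonicOrthogonal_P.isJacobiSolution_of_map_X_mul S.isJacobiSolution_P
    (S.isLinearMap_transform hx) (e := -1) fun p => by
      rw [S.transform_X_mul p hx, smul_eq_mul, mul_neg_one, sub_eq_add_neg]

theorem tendsto_pow_mul_transform_P_zero {k n : ℕ} (hk : k ≤ n) :
    Tendsto (fun x => x ^ k * S.transform (S.P n) x) atTop (𝓝 0) := by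
  refine (S.tendsto_transform (X ^ k * S.P n)).congr' ?_
  filter_upwards [eventually_gt_atTop 1] with x hx
  exact S.transform_X_pow_mul_P hk hx

theorem tendsto_pow_mul_casoratian (ρ : ℝ) (M n : ℕ) :
    Tendsto (fun x => x ^ n * casoratian (fun k => S.transform (S.P k) x)
      (rescaledShift ρ M fun k => S.transform (S.P k) x) n) atTop (𝓝 0) := by
  have hshift (m : ℕ) : Tendsto (fun x => rescaledShift ρ M (fun k => S.transform (S.P k) x) m)
      atTop (𝓝 0) := by
    cases m with
    | zero => exact mul_zero ρ ▸ (S.tendsto_transform (S.P M)).const_mul ρ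
    | succ m => exact S.tendsto_transform _
  have h := ((S.tendsto_pow_mul_transform_P_zero (le_refl n)).mul (hshift (n + 1))).sub
    ((S.tendsto_pow_mul_transform_P_zero (Nat.le_succ n)).mul (hshift n))
  simp only [mul_zero, sub_zero] at h
  refine h.congr fun x => ?_
  rw [casoratian]
  ring

theorem a_one : S.a 1 = S.h 1 := by
  rw [← S.a_succ_mul_h 0, h_zero, mul_one]

theorem isJacobiSolution_rescaledShift {A : Type*} [CommRing A] [Algebra ℝ A] {x : A} {y : ℕ → A}
    {M : ℕ} (hM : S.HasPeriod M) (hy : IsJacobiSolution S.a S.b x y) :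
    IsJacobiSolution S.a S.b x (rescaledShift (S.a (M + 1) / S.a 1) M y) :=
  hy.shift (div_mul_cancel₀ _ (S.a_one ▸ (S.h_pos 1).ne')).symm hM.1
    fun n hn => hM.2 n (one_le_two.trans hn)

-- The `n`-th Casoratian is `o(x ^ (-n))`, and it is `h_n` times the initial one.
theorem superpolynomialDecay_casoratian {M : ℕ} (hM : S.HasPeriod M) :
    SuperpolynomialDecay atTop id fun x => casoratian (fun k => S.transform (S.P k) x)
      (rescaledShift (S.a (M + 1) / S.a 1) M fun k => S.transform (S.P k) x) 0 := fun n => by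
  have h := (S.tendsto_pow_mul_casoratian (S.a (M + 1) / S.a 1) M n).const_mul (S.h n)⁻¹
  rw [mul_zero] at h
  refine h.congr' ?_
  filter_upwards [eventually_gt_atTop 1] with x hx
  have hq := S.isJacobiSolution_transform_P hx
  rw [hq.casoratian_eq_smul S.h_zero (fun n => (S.a_succ_mul_h n).symm)
    (S.isJacobiSolution_rescaledShift hM hq) n, smul_eq_mul, mul_left_comm (x ^ n),
    inv_mul_cancel_left₀ (S.h_pos n).ne', id]

theorem denom_mul_casoratian_eq (ρ : ℝ) (M : ℕ) {x : ℝ} (hx : 1 < x) :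
    casoratian (fun k => S.transform (S.P k) x)
        (rescaledShift ρ M fun k => S.transform (S.P k) x) 0 * S.denom.eval x =
      ((S.P (M + 1) - C ρ * S.P 1 * S.P M) * S.numer - C ρ * S.Q M * S.denom).eval x -
        ((S.Q (M + 1) - C ρ * (S.P 1 * S.Q M + S.P M)) * S.denom).eval x * S.transform 1 x := by
  have hsq := S.transform_one_sq hx
  rw [eq_div_iff (S.eval_denom_ne_zero hx)] at hsq
  simp only [casoratian, rescaledShift, zero_add, add_comm 1 M, S.transform_P _ hx, Q_one, P_zero,
    eval_one, eval_sub, eval_mul, eval_C, eval_add, smul_eq_mul]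
  linear_combination ((S.P (M + 1)).eval x - ρ * (S.P 1).eval x * (S.P M).eval x) * hsq

theorem tendsto_eval_P_div_pow (n : ℕ) :
    Tendsto (fun x => (S.P n).eval x / x ^ n) atTop (𝓝 1) := by
  have h := div_tendsto_atTop_leadingCoeff_div_of_degree_eq (S.P n) (X ^ n) (by
    rw [degree_eq_natDegree (S.isMonicOrthogonal_P.monic n).ne_zero,
      S.isMonicOrthogonal_P.natDegree_eq, degree_X_pow])
  simpa [(S.isMonicOrthogonal_P.monic n).leadingCoeff] using h

theorem tendsto_mul_transform_one : Tendsto (fun x => x * S.transform 1 x) atTop (𝓝 1) :=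
  S.moment_one ▸ S.tendsto_mul_transform 1

theorem tendsto_eval_Q_succ_div_pow (n : ℕ) :
    Tendsto (fun x => (S.Q (n + 1)).eval x / x ^ n) atTop (𝓝 1) := by
  have hq : Tendsto (fun x => S.transform (S.P (n + 1)) x / x ^ n) atTop (𝓝 0) := by
    have h := (S.tendsto_transform (S.P (n + 1))).mul
      (tendsto_inv_atTop_zero.pow n : Tendsto (fun x : ℝ => x⁻¹ ^ n) atTop _)
    rw [zero_mul] at h
    simpa only [inv_pow, ← div_eq_mul_inv] using h
  have h := ((S.tendsto_eval_P_div_pow (n + 1)).mul S.tendsto_mul_transform_one).sub hq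
  rw [mul_one, sub_zero] at h
  refine h.congr' ?_
  filter_upwards [eventually_gt_atTop 1] with x hx
  have hx0 : x ≠ 0 := (zero_lt_one.trans hx).ne'
  rw [S.transform_P _ hx, pow_succ]
  field_simp
  ring

theorem rescaledShift_relations {M : ℕ} (hM : S.HasPeriod M) :
    (S.P (M + 1) - C (S.a (M + 1) / S.a 1) * S.P 1 * S.P M) * S.numer =
        C (S.a (M + 1) / S.a 1) * S.Q M * S.denom ∧
      S.Q (M + 1) = C (S.a (M + 1) / S.a 1) * (S.P 1 * S.Q M + S.P M) := by
  have hdecay := (S.superpolynomialDecay_casoratian hM).mul_polynomial S.denom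
  have hzero := S.eq_zero_of_superpolynomialDecay_sub (hdecay.congr' (by
    filter_upwards [eventually_gt_atTop 1] with x hx
    exact S.denom_mul_casoratian_eq _ M hx))
  refine ⟨sub_eq_zero.1 hzero.1, sub_eq_zero.1 ?_⟩
  exact (mul_eq_zero.1 hzero.2).resolve_right S.monic_denom.ne_zero

theorem a_period_succ_div {M : ℕ} (hM : S.HasPeriod M) (hpos : 0 < M) :
    S.a (M + 1) / S.a 1 = 1 / 2 := by
  obtain ⟨m, rfl⟩ := Nat.exists_eq_add_one.2 hpos
  set ρ := S.a (m + 1 + 1) / S.a 1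
  have hlim := (((S.tendsto_eval_P_div_pow 1).mul (S.tendsto_eval_Q_succ_div_pow m)).add
    (S.tendsto_eval_P_div_pow (m + 1))).const_mul ρ
  have hρ := tendsto_nhds_unique (S.tendsto_eval_Q_succ_div_pow (m + 1)) (hlim.congr fun x => ?_)
  · linarith
  · rw [(S.rescaledShift_relations hM).2, eval_mul, eval_C, eval_add, eval_mul]
    ring

/-- The polynomial part `2 P_{M+1} - P_1 P_M` of the addition formula for a period `M`. Away from
the zeros of `numer` it is `Q_M / ψ ^ 2`, see `QDivPsiSq_mul_numer`. -/
noncomputable def QDivPsiSq (M : ℕ) : ℝ[X] := 2 * S.P (M + 1) - S.P 1 * S.P M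

theorem QDivPsiSq_mul_numer {M : ℕ} (hM : S.HasPeriod M) (hpos : 0 < M) :
    S.QDivPsiSq M * S.numer = S.Q M * S.denom := by
  have h := (S.rescaledShift_relations hM).1
  rw [S.a_period_succ_div hM hpos] at h
  rw [QDivPsiSq]
  linear_combination 2 * h +
    (S.P 1 * S.P M * S.numer + S.Q M * S.denom) * two_mul_C_one_div_two (F := ℝ)

theorem two_mul_Q_period_succ {M : ℕ} (hM : S.HasPeriod M) (hpos : 0 < M) :
    2 * S.Q (M + 1) = S.P 1 * S.Q M + S.P M := by
  have h := (S.rescaledShift_relations hM).2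
  rw [S.a_period_succ_div hM hpos] at h
  linear_combination 2 * h + (S.P 1 * S.Q M + S.P M) * two_mul_C_one_div_two (F := ℝ)

theorem two_mul_P_add_period {M n : ℕ} (hM : S.HasPeriod M) (hpos : 0 < M) (hn : 0 < n) :
    2 * S.P (n + M) = S.P n * S.P M + S.Q n * S.QDivPsiSq M := by
  have hshift := (S.isJacobiSolution_rescaledShift hM S.isJacobiSolution_P).mul_const 2
  have hsum := (S.isJacobiSolution_P.mul_const (S.P M)).add
    (S.isJacobiSolution_Q.mul_const (S.QDivPsiSq M))
  obtain ⟨m, rfl⟩ := Nat.exists_eq_add_one.2 hn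
  rw [mul_comm]
  refine hshift.ext hsum ?_ ?_ (m + 1)
  · rw [S.a_period_succ_div hM hpos, rescaledShift, smul_eq_C_mul, P_zero, Q_zero]
    linear_combination S.P M * two_mul_C_one_div_two (F := ℝ)
  · rw [rescaledShift, Q_one, QDivPsiSq, zero_add, add_comm 1 M]
    ring

theorem two_mul_Q_add_period {M n : ℕ} (hM : S.HasPeriod M) (hpos : 0 < M) (hn : 0 < n) :
    2 * S.Q (n + M) = S.P n * S.Q M + S.Q n * S.P M := by
  have hshift := (S.isJacobiSolution_rescaledShift hM S.isJacobiSolution_Q).mul_const 2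
  have hsum := (S.isJacobiSolution_P.mul_const (S.Q M)).add
    (S.isJacobiSolution_Q.mul_const (S.P M))
  obtain ⟨m, rfl⟩ := Nat.exists_eq_add_one.2 hn
  rw [mul_comm]
  refine hshift.ext hsum ?_ ?_ (m + 1)
  · rw [S.a_period_succ_div hM hpos, rescaledShift, smul_eq_C_mul, P_zero, Q_zero]
    linear_combination S.Q M * two_mul_C_one_div_two (F := ℝ)
  · rw [rescaledShift, Q_one, zero_add, add_comm 1 M]
    linear_combination S.two_mul_Q_period_succ hM hpos

theorem P_sq_sub_Q_mul_QDivPsiSq {M : ℕ} (hM : S.HasPeriod M) (hpos : 0 < M) :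
    S.P M ^ 2 - S.Q M * S.QDivPsiSq M = 2 * C (S.h M) := by
  have h := S.isJacobiSolution_P.casoratian_eq_smul S.h_zero (fun n => (S.a_succ_mul_h n).symm)
    S.isJacobiSolution_Q M
  rw [casoratian, casoratian, P_zero, Q_zero, Q_one, smul_eq_C_mul] at h
  rw [QDivPsiSq]
  linear_combination 2 * h - S.P M * S.two_mul_Q_period_succ hM hpos

end Periodicity

section Reflection

open Filter Topology

theorem tendsto_eval_QDivPsiSq_div_pow (M : ℕ) :
    Tendsto (fun x => (S.QDivPsiSq M).eval x / x ^ (M + 1)) atTop (𝓝 1) := by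
  have h := ((S.tendsto_eval_P_div_pow (M + 1)).const_mul 2).sub
    ((S.tendsto_eval_P_div_pow 1).mul (S.tendsto_eval_P_div_pow M))
  rw [show (2 : ℝ) * 1 - 1 * 1 = 1 by norm_num] at h
  refine h.congr fun x => ?_
  rw [QDivPsiSq, eval_sub, eval_mul, eval_mul, eval_ofNat]
  ring

theorem eval_QDivPsiSq_mul_transform_sq {M : ℕ} (hM : S.HasPeriod M) (hpos : 0 < M) {x : ℝ}
    (hx : 1 < x) :
    (S.QDivPsiSq M).eval x * S.transform 1 x ^ 2 = (S.Q M).eval x := by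
  have h := congrArg (eval x) (S.QDivPsiSq_mul_numer hM hpos)
  rw [eval_mul, eval_mul] at h
  rw [S.transform_one_sq hx, mul_div_assoc', h, mul_div_cancel_right₀ _ (S.eval_denom_ne_zero hx)]

/-- The polynomial `P_j P_M - Q_j Q_M / ψ ^ 2`, which for a period `M > j` equals
`h_j P_{M-j}`. -/
noncomputable def reflectedP (M j : ℕ) : ℝ[X] := S.P j * S.P M - S.Q j * S.QDivPsiSq M

/-- The polynomial `P_j Q_M - Q_j P_M`, which for a period `M > j` equals `h_j Q_{M-j}`. -/
noncomputable def reflectedQ (M j : ℕ) : ℝ[X] := S.P j * S.Q M - S.Q j * S.P M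

theorem isJacobiSolution_reflectedP (M : ℕ) : IsJacobiSolution S.a S.b X (S.reflectedP M) :=
  (S.isJacobiSolution_P.mul_const _).sub (S.isJacobiSolution_Q.mul_const _)

theorem isJacobiSolution_reflectedQ (M : ℕ) : IsJacobiSolution S.a S.b X (S.reflectedQ M) :=
  (S.isJacobiSolution_P.mul_const _).sub (S.isJacobiSolution_Q.mul_const _)

theorem eval_reflectedP_mul_transform {M : ℕ} (hM : S.HasPeriod M) (hpos : 0 < M) (j : ℕ) {x : ℝ}
    (hx : 1 < x) :
    (S.reflectedP M j).eval x * S.transform 1 x =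
      (S.QDivPsiSq M).eval x * S.transform (S.P j) x * S.transform 1 x +
        (S.P j).eval x * S.transform (S.P M) x := by
  rw [S.transform_P j hx, S.transform_P M hx, reflectedP, eval_sub, eval_mul, eval_mul]
  linear_combination -(S.P j).eval x * S.eval_QDivPsiSq_mul_transform_sq hM hpos hx

theorem tendsto_eval_reflectedP_div_pow {M j k : ℕ} (hM : S.HasPeriod M) (hk : 0 < k)
    (hjk : j + k = M) :
    Tendsto (fun x => (S.reflectedP M j).eval x / x ^ k) atTop (𝓝 (S.h j)) := by
  subst hjk
  have hψ := S.tendsto_mul_transform_one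
  have hsmall := ((S.tendsto_eval_P_div_pow j).mul
    (S.tendsto_pow_mul_transform_P_zero (Nat.add_le_add_left hk j))).mul
      (tendsto_inv_atTop_zero.pow k : Tendsto (fun x : ℝ => x⁻¹ ^ k) atTop _)
  have hmain :=
    ((S.tendsto_eval_QDivPsiSq_div_pow (j + k)).mul (S.tendsto_pow_mul_transform_P j)).mul hψ
  have h := (hmain.add hsmall).div hψ one_ne_zero
  simp only [one_mul, mul_one, div_one, mul_zero, zero_mul, add_zero] at h
  refine h.congr' ?_
  filter_upwards [eventually_gt_atTop 1, hψ.eventually_ne one_ne_zero] with x hx hψx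
  have : x ≠ 0 := (zero_lt_one.trans hx).ne'
  have heval := S.eval_reflectedP_mul_transform hM (Nat.add_pos_right j hk) j hx
  rw [Pi.div_apply, div_eq_iff hψx, div_mul_eq_mul_div (eval x (S.reflectedP _ _)),
    mul_left_comm (eval x (S.reflectedP _ _)), heval, inv_pow]
  field_simp
  ring

theorem eq_of_tendsto_div_pow {k : ℕ} {c d l : ℝ}
    (h : Tendsto (fun x => (C c * S.P (k + 1) + C d * S.P k).eval x / x ^ k) atTop (𝓝 l)) :
    c = 0 ∧ d = l := by
  have hlim := ((S.tendsto_eval_P_div_pow (k + 1)).const_mul c).add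
    (((S.tendsto_eval_P_div_pow k).const_mul d).mul tendsto_inv_atTop_zero)
  have hc : c = 0 := by
    have h0 := tendsto_nhds_unique (h.mul tendsto_inv_atTop_zero) (hlim.congr fun x => ?_)
    · simpa using h0.symm
    · rw [eval_add, eval_mul, eval_mul, eval_C, eval_C]
      ring
  refine ⟨hc, tendsto_nhds_unique ?_ h⟩
  refine (mul_one d ▸ (S.tendsto_eval_P_div_pow k).const_mul d).congr fun x => ?_
  rw [hc, C_0, zero_mul, zero_add, eval_mul, eval_C, mul_div_assoc]

theorem reflected_add_two {R T : ℕ → ℝ[X]} (hR : IsJacobiSolution S.a S.b X R)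
    (hT : IsJacobiSolution S.a S.b X T) {j k : ℕ} (h₀ : T j = C (S.h j) * R (k + 2))
    (h₁ : T (j + 1) = C (S.h (j + 1)) * R (k + 1)) :
    T (j + 2) = C (S.h (j + 1) * (S.b (k + 2) - S.b (j + 2))) * R (k + 1) +
      C (S.h (j + 1) * S.a (k + 1)) * R k := by
  rw [hT j, h₀, h₁, hR k, ← S.a_succ_mul_h j]
  simp only [smul_eq_C_mul, C_mul, C_sub]
  ring

theorem b_period_succ {M : ℕ} (hM : S.HasPeriod M) : S.b (M + 1) = S.b 1 := by
  rw [add_comm, hM.2 1 le_rfl]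

theorem reflectedP_one {k : ℕ} (hM : S.HasPeriod (k + 1)) :
    S.reflectedP (k + 1) 1 = C (2 * S.a (k + 1)) * S.P k := by
  rw [reflectedP, Q_one, QDivPsiSq, S.isJacobiSolution_P k, P_one, S.b_period_succ hM]
  simp only [smul_eq_C_mul, C_mul, C_ofNat]
  ring

theorem reflectedQ_one {k : ℕ} (hM : S.HasPeriod (k + 1)) :
    S.reflectedQ (k + 1) 1 = C (2 * S.a (k + 1)) * S.Q k := by
  have h := S.two_mul_Q_period_succ hM k.succ_pos
  rw [S.isJacobiSolution_Q k, P_one, S.b_period_succ hM] at h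
  rw [reflectedQ, Q_one, P_one]
  simp only [smul_eq_C_mul, C_mul, C_ofNat] at h ⊢
  linear_combination h

theorem reflected_eq {M : ℕ} (hM : S.HasPeriod M) {j k : ℕ} (hk : 0 < k) (hjk : j + k = M) :
    S.reflectedP M j = C (S.h j) * S.P k ∧ S.reflectedQ M j = C (S.h j) * S.Q k := by
  obtain ⟨k, rfl⟩ := Nat.exists_eq_add_one.2 hk
  induction j using Nat.twoStepInduction generalizing k with
  | zero =>
    obtain rfl : k + 1 = M := by rw [← hjk, zero_add]
    simp [reflectedP, reflectedQ, P_zero, Q_zero, h_zero]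
  | one =>
    obtain rfl : k + 1 + 1 = M := by rw [← hjk, add_comm]
    have hlim := S.tendsto_eval_reflectedP_div_pow hM hk hjk
    rw [S.reflectedP_one hM, ← zero_add (C _ * _), ← zero_mul (S.P (k + 1 + 1)), ← C_0] at hlim
    rw [S.reflectedP_one hM, S.reflectedQ_one hM, (S.eq_of_tendsto_div_pow hlim).2]
    exact ⟨rfl, rfl⟩
  | more j ih₀ ih₁ =>
    have hjk₀ : j + (k + 2 + 1) = M := by rw [← hjk]; ring
    have hjk₁ : j + 1 + (k + 1 + 1) = M := by rw [← hjk]; ring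
    obtain ⟨hP₀, hQ₀⟩ := ih₀ (k + 2) (Nat.succ_pos _) hjk₀
    obtain ⟨hP₁, hQ₁⟩ := ih₁ (k + 1) (Nat.succ_pos _) hjk₁
    have hP := S.reflected_add_two S.isJacobiSolution_P (S.isJacobiSolution_reflectedP M) hP₀ hP₁
    have hQ := S.reflected_add_two S.isJacobiSolution_Q (S.isJacobiSolution_reflectedQ M) hQ₀ hQ₁
    have hlim := S.tendsto_eval_reflectedP_div_pow hM hk hjk
    rw [hP] at hlim
    obtain ⟨hb, ha⟩ := S.eq_of_tendsto_div_pow hlim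
    rw [hP, hQ, hb, ha, C_0, zero_mul, zero_add, zero_mul, zero_add]
    exact ⟨rfl, rfl⟩

end Reflection

section Evaluation

variable {M n : ℕ} (hM : S.HasPeriod M)

include hM

theorem two_mul_evalP_add (hpos : 0 < M) (hn : 0 < n) (z : ℂ) :
    2 * S.evalP (n + M) z =
      S.evalP n z * S.evalP M z + S.evalQ n z * aeval z (S.QDivPsiSq M) := by
  have h := congrArg (aeval z) (S.two_mul_P_add_period hM hpos hn)
  simpa only [evalP, evalQ_eq_aeval, map_mul, map_add, map_ofNat] using h

theorem two_mul_evalQ_add (hpos : 0 < M) (hn : 0 < n) (z : ℂ) :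
    2 * S.evalQ (n + M) z = S.evalP n z * S.evalQ M z + S.evalQ n z * S.evalP M z := by
  have h := congrArg (aeval z) (S.two_mul_Q_add_period hM hpos hn)
  simpa only [evalP, evalQ_eq_aeval, map_mul, map_add, map_ofNat] using h

theorem evalP_sq_sub (hpos : 0 < M) (z : ℂ) :
    S.evalP M z ^ 2 - S.evalQ M z * aeval z (S.QDivPsiSq M) = 2 * S.h M := by
  have h := congrArg (aeval z) (S.P_sq_sub_Q_mul_QDivPsiSq hM hpos)
  simpa only [evalP, evalQ_eq_aeval, map_mul, map_sub, map_pow, map_ofNat, aeval_C,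
    Complex.coe_algebraMap] using h

theorem h_mul_evalP_sub (hn : n < M) (z : ℂ) :
    S.h n * S.evalP (M - n) z =
      S.evalP n z * S.evalP M z - S.evalQ n z * aeval z (S.QDivPsiSq M) := by
  have h := congrArg (aeval z)
    (S.reflected_eq hM (Nat.sub_pos_of_lt hn) (Nat.add_sub_of_le hn.le)).1
  simpa only [evalP, evalQ_eq_aeval, reflectedP, map_mul, map_sub, aeval_C,
    Complex.coe_algebraMap] using h.symm

theorem h_mul_evalQ_sub (hn : n < M) (z : ℂ) :
    S.h n * S.evalQ (M - n) z = S.evalP n z * S.evalQ M z - S.evalQ n z * S.evalP M z := by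
  have h := congrArg (aeval z)
    (S.reflected_eq hM (Nat.sub_pos_of_lt hn) (Nat.add_sub_of_le hn.le)).2
  simpa only [evalP, evalQ_eq_aeval, reflectedQ, map_mul, map_sub, aeval_C,
    Complex.coe_algebraMap] using h.symm

theorem evalP_mul_evalP_of_gt (hpos : 0 < M) (hn : M < n) (z : ℂ) :
    S.evalP n z * S.evalP M z = S.evalP (n + M) z + S.h M / 2 * S.evalP (n - M) z := by
  obtain ⟨k, rfl⟩ := Nat.exists_eq_add_of_le' hn.le
  have hk : 0 < k := by omega
  rw [Nat.add_sub_cancel]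
  linear_combination (-1 / 2) * S.two_mul_evalP_add hM hpos (hpos.trans hn) z +
    S.evalP M z / 4 * S.two_mul_evalP_add hM hpos hk z -
    aeval z (S.QDivPsiSq M) / 4 * S.two_mul_evalQ_add hM hpos hk z +
    S.evalP k z / 4 * S.evalP_sq_sub hM hpos z

theorem evalP_mul_evalP_of_lt (hn₀ : 0 < n) (hn : n < M) (z : ℂ) :
    S.evalP n z * S.evalP M z = S.evalP (n + M) z + S.h n / 2 * S.evalP (M - n) z := by
  linear_combination (-1 / 2) * S.two_mul_evalP_add hM (hn₀.trans hn) hn₀ z -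
    1 / 2 * S.h_mul_evalP_sub hM hn z

theorem evalP_mul_self (hpos : 0 < M) (z : ℂ) :
    S.evalP M z * S.evalP M z = S.evalP (2 * M) z + S.h M := by
  rw [two_mul]
  linear_combination (-1 / 2) * S.two_mul_evalP_add hM hpos hpos z +
    1 / 2 * S.evalP_sq_sub hM hpos z

theorem evalQ_mul_evalP_self (hpos : 0 < M) (z : ℂ) :
    S.evalQ M z * S.evalP M z = S.evalQ (M + M) z := by
  linear_combination (-1 / 2) * S.two_mul_evalQ_add hM hpos hpos z

omit hM in
theorem evalQ_zero (z : ℂ) : S.evalQ 0 z = 0 := by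
  rw [evalQ_eq_aeval, Q_zero, map_zero]

theorem evalQ_mul_evalP_of_ge (hpos : 0 < M) (hn : M ≤ n) (z : ℂ) :
    S.evalQ n z * S.evalP M z = S.evalQ (n + M) z + S.h M / 2 * S.evalQ (n - M) z := by
  rcases hn.eq_or_lt with rfl | hlt
  · rw [Nat.sub_self, evalQ_zero, mul_zero, add_zero, S.evalQ_mul_evalP_self hM hpos]
  obtain ⟨k, rfl⟩ := Nat.exists_eq_add_of_le' hn
  have hk : 0 < k := by omega
  rw [Nat.add_sub_cancel]
  linear_combination (-1 / 2) * S.two_mul_evalQ_add hM hpos (hpos.trans_le hn) z +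
    S.evalP M z / 4 * S.two_mul_evalQ_add hM hpos hk z -
    S.evalQ M z / 4 * S.two_mul_evalP_add hM hpos hk z +
    S.evalQ k z / 4 * S.evalP_sq_sub hM hpos z

theorem evalQ_mul_evalP_of_le (hn₀ : 0 < n) (hn : n ≤ M) (z : ℂ) :
    S.evalQ n z * S.evalP M z = S.evalQ (n + M) z - S.h n / 2 * S.evalQ (M - n) z := by
  rcases hn.eq_or_lt with rfl | hlt
  · rw [Nat.sub_self, evalQ_zero, mul_zero, sub_zero, S.evalQ_mul_evalP_self hM hn₀]
  · linear_combination (-1 / 2) * S.two_mul_evalQ_add hM (hn₀.trans_le hn) hn₀ z +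
      1 / 2 * S.h_mul_evalQ_sub hM hlt z

theorem aeval_QDivPsiSq (hpos : 0 < M) {z : ℂ} (hz : ∀ i, z ≠ S.α i) :
    aeval z (S.QDivPsiSq M) = S.evalQ M z / S.psi z ^ 2 := by
  have h := congrArg (aeval z) (S.QDivPsiSq_mul_numer hM hpos)
  rw [map_mul, map_mul] at h
  have hnumer : aeval z S.numer ≠ 0 := by
    rw [aeval_numer, Finset.prod_ne_zero_iff]
    exact fun i _ => sub_ne_zero.2 (hz i)
  rw [S.psi_sq hz, evalQ_eq_aeval, div_div_eq_mul_div, eq_div_iff hnumer, h]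

theorem evalP_sub (hn : n < M) {z : ℂ} (hz : ∀ i, z ≠ S.α i) :
    S.evalP (M - n) z = 1 / S.h n *
      (S.evalP M z * S.evalP n z - S.evalQ M z * S.evalQ n z / S.psi z ^ 2) := by
  have hh : (S.h n : ℂ) ≠ 0 := Complex.ofReal_ne_zero.2 (S.h_pos n).ne'
  rw [one_div, eq_inv_mul_iff_mul_eq₀ hh, S.h_mul_evalP_sub hM hn,
    S.aeval_QDivPsiSq hM (by omega) hz]
  ring

theorem evalQ_sub (hn : n < M) (z : ℂ) :
    S.evalQ (M - n) z = 1 / S.h n * (S.evalQ M z * S.evalP n z - S.evalP M z * S.evalQ n z) := by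
  have hh : (S.h n : ℂ) ≠ 0 := Complex.ofReal_ne_zero.2 (S.h_pos n).ne'
  rw [one_div, eq_inv_mul_iff_mul_eq₀ hh, S.h_mul_evalQ_sub hM hn]
  ring

end Evaluation

end BranchPoints

theorem lemma1 {g : ℕ} (S : BranchPoints g) (K : ℕ) (hK : 1 ≤ K) (hper : S.HasPeriod K) :
    -- products `P_n P_{mK}`, with the exact form in the case `n = mK`
    (∀ m n : ℕ, 1 ≤ m → m * K < n → ∀ z : ℂ,
      S.evalP n z * S.evalP (m * K) z =
        S.evalP (n + m * K) z + (S.h (m * K) : ℂ) / 2 * S.evalP (n - m * K) z) ∧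
    (∀ m n : ℕ, 1 ≤ n → n < m * K → ∀ z : ℂ,
      S.evalP n z * S.evalP (m * K) z =
        S.evalP (n + m * K) z + (S.h n : ℂ) / 2 * S.evalP (m * K - n) z) ∧
    (∀ m : ℕ, 1 ≤ m → ∀ z : ℂ,
      S.evalP (m * K) z * S.evalP (m * K) z =
        S.evalP (2 * (m * K)) z + (S.h (m * K) : ℂ)) ∧
    -- products `Q_n P_{mK}`
    (∀ m n : ℕ, 1 ≤ m → m * K ≤ n → ∀ z : ℂ,
      S.evalQ n z * S.evalP (m * K) z =
        S.evalQ (n + m * K) z + (S.h (m * K) : ℂ) / 2 * S.evalQ (n - m * K) z) ∧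
    (∀ m n : ℕ, 1 ≤ n → n ≤ m * K → ∀ z : ℂ,
      S.evalQ n z * S.evalP (m * K) z =
        S.evalQ (n + m * K) z - (S.h n : ℂ) / 2 * S.evalQ (m * K - n) z) ∧
    -- `P_{nK-j}` and `Q_{nK-j}`
    (∀ n j : ℕ, 1 ≤ n → 1 ≤ j → j < K → ∀ z : ℂ, (∀ i, z ≠ (S.α i : ℂ)) →
      S.evalP (n * K - j) z =
        1 / (S.h j : ℂ) * (S.evalP (n * K) z * S.evalP j z -
          S.evalQ (n * K) z * S.evalQ j z / S.psi z ^ 2)) ∧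
    (∀ n j : ℕ, 1 ≤ n → 1 ≤ j → j < K → ∀ z : ℂ,
      S.evalQ (n * K - j) z =
        1 / (S.h j : ℂ) * (S.evalQ (n * K) z * S.evalP j z -
          S.evalP (n * K) z * S.evalQ j z)) := by
  have hpos {m : ℕ} (hm : 1 ≤ m) : 0 < m * K := Nat.mul_pos hm hK
  have hlt {n j : ℕ} (hn : 1 ≤ n) (hj : j < K) : j < n * K :=
    hj.trans_le (Nat.le_mul_of_pos_left K hn)
  exact ⟨fun m _ hm hn => S.evalP_mul_evalP_of_gt (hper.mul m) (hpos hm) hn,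
    fun m _ hn₀ hn => S.evalP_mul_evalP_of_lt (hper.mul m) hn₀ hn,
    fun m hm => S.evalP_mul_self (hper.mul m) (hpos hm),
    fun m _ hm hn => S.evalQ_mul_evalP_of_ge (hper.mul m) (hpos hm) hn,
    fun m _ hn₀ hn => S.evalQ_mul_evalP_of_le (hper.mul m) hn₀ hn,
    fun n _ hn _ hj _ hz => S.evalP_sub (hper.mul n) (hlt hn hj) hz,
    fun n _ hn _ hj => S.evalQ_sub (hper.mul n) (hlt hn hj)⟩
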